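/- **Theorem (Weak Structure Theorem).** *Setting.* Let $k$ be a commutative ring, $A$ and $L$ (associative unital) $k$-algebras, $\mathcal C$ an $A$-coring with coproduct $\Delta_{\mathcal C}(c)=c^{(1)}\otimes_A c^{(2)}$ and counit $\epsilon_{\mathcal C}$, and $\mathcal D$ an $L$-coring with coproduct $d\mapsto d_{(1)}\otimes_L d_{(2)}$. (Corings are coassociative and counital, and so are all comodules below.) A right $\mathcal C$-comodule $M$ has coaction $\varrho^M(m)=m^{[0]}\otimes_A m^{[1]}$; $\mathcal M^{\mathcal C}$ denotes the category of right $\mathcal C$-comodules. Let $\mathcal D$ be a *right extension* of $\mathcal C$: $\mathcal C$ is an $A$-$L$ bimodule (extending its left $A$-module structure) and a $\mathcal C$-$\mathcal D$ bicomodule, with left coaction $\Delta_{\mathcal C}$ and a right $\mathcal D$-coaction $\tau_{\mathcal C}:c\mapsto c_{[0]}\otimes_L c_{[1]}$; that is, $\tau_{\mathcal C}$ is left $A$-linear, and $\Delta_{\mathcal C}$ is right $L$-linear and right $\mathcal D$-colinear. Every right $\mathcal C$-comodule $M$ is a right $L$-module through $ml=m^{[0]}\epsilon_{\mathcal C}(m^{[1]}l)$.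 Assume the extension is *pure*: for every right $\mathcal C$-comodule $M$ the equaliser $$M\xrightarrow{\ \varrho^M\ } M\otimes_A\mathcal C\ \rightrightarrows\ M\otimes_A\mathcal C\otimes_A\mathcal C$$ of $\varrho^M\otimes_A\mathcal C$ and $M\otimes_A\Delta_{\mathcal C}$ in the category of right $L$-modules is preserved by $-\otimes_L(\mathcal D\otimes_L\mathcal D)$. Then every right $\mathcal C$-comodule $M$ is a right $\mathcal D$-comodule via $\tau_M(m)=m^{[0]}\epsilon_{\mathcal C}(m^{[1]}{}_{[0]})\otimes_L m^{[1]}{}_{[1]}$, i.e. $\tau_M(m)$ is the unique element of $M\otimes_L\mathcal D$ with $(\varrho^M\otimes_L\mathcal D)(\tau_M(m))=m^{[0]}\otimes_A m^{[1]}{}_{[0]}\otimes_L m^{[1]}{}_{[1]}$. Let $\Sigma$ be an $L$-$\mathcal C$ bicomodule, i.e. an $L$-$A$ bimodule and a right $\mathcal C$-comodule whose $\mathcal C$-coaction is left $L$-linear. Let $T=\mathrm{End}^{\mathcal C}(\Sigma)$, with composition as product, viewed as an $L$-$L$ bimodule via $L\to T$, $l\mapsto(x\mapsto lx)$, and let $\Sigma^*=\mathrm{Hom}_A(\Sigma,A)$,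 with $(a\xi l)(x)=a\,\xi(lx)$. Consider - the algebra ${}_L\mathrm{Hom}_L(\mathcal D,T)$ of bimodule maps with product $(vv')(d)=v(d_{(1)})v'(d_{(2)})$ and unit $d\mapsto\epsilon_{\mathcal D}(d)1_T$; - the left ${}_L\mathrm{Hom}_L(\mathcal D,T)$-module ${}_L\mathrm{Hom}^{\mathcal D}(\mathcal D,\Sigma)$ of left $L$-linear right $\mathcal D$-colinear maps, with $(vp)(d)=v(d_{(1)})(p(d_{(2)}))$; - the right ${}_L\mathrm{Hom}_L(\mathcal D,T)$-module $$\widetilde Q=\{q\in{}_A\mathrm{Hom}_L(\mathcal C,\Sigma^*)\mid c^{(1)}q(c^{(2)})(x)=q(c)(x^{[0]})\,x^{[1]}\ \text{ for all } x\in\Sigma,\ c\in\mathcal C\},$$ with $(qv)(c)=q(c_{[0]})\circ v(c_{[1]})$; - the $k$-module ${}^{\mathcal C}\mathrm{End}^{\mathcal D}(\mathcal C)$ of left $\mathcal C$-colinear and right $\mathcal D$-colinear endomorphisms of $\mathcal C$. The connecting map $\blacklozenge$ of the Morita context $\widetilde{\mathbb M}(\Sigma)$ is the well-defined map $$\blacklozenge:\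 \widetilde Q\otimes_{{}_L\mathrm{Hom}_L(\mathcal D,T)}{}_L\mathrm{Hom}^{\mathcal D}(\mathcal D,\Sigma)\to{}^{\mathcal C}\mathrm{End}^{\mathcal D}(\mathcal C),\qquad (q\blacklozenge p)(c)=c^{(1)}\,q(c^{(2)}{}_{[0]})\big(p(c^{(2)}{}_{[1]})\big).$$ *Claim.* If $\blacklozenge$ is surjective, then: 1. The functor $\mathrm{Hom}^{\mathcal C}(\Sigma,-):\mathcal M^{\mathcal C}\to\mathcal M_T$, where $T$ acts by composition, is fully faithful. 2. $\Sigma$ is a Galois $\mathcal C$-comodule: for every right $A$-module $N$ the map $$\mathrm{can}_N:\mathrm{Hom}_A(\Sigma,N)\otimes_T\Sigma\to N\otimes_A\mathcal C,\qquad \phi\otimes x\mapsto\phi(x^{[0]})\otimes_A x^{[1]}$$ is bijective. 3. For every right $\mathcal C$-comodule $M$ the counit $$\varepsilon_M:\mathrm{Hom}^{\mathcal C}(\Sigma,M)\otimes_T\Sigma\to M,\qquad \varphi\otimes x\mapsto\varphi(x)$$ of the adjunction between $-\otimes_T\Sigma:\mathcal M_T\to\mathcal M^{\mathcal C}$ and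 $\mathrm{Hom}^{\mathcal C}(\Sigma,-)$ is an isomorphism of $\mathcal C$-comodules, and its inverse is $\mathrm{can}_M^{-1}\circ\varrho^M$. More precisely, the map $\mathrm{Hom}^{\mathcal C}(\Sigma,M)\otimes_T\Sigma\to\mathrm{Hom}_A(\Sigma,M)\otimes_T\Sigma$ induced by the inclusion is injective, and $\mathrm{can}_M^{-1}\circ\varrho^M$ takes its values in the image of this map. -/

import Mathlib

universe u

open MulOpposite CategoryTheory

namespace CoringMorita

noncomputable section

/-! ### Tensor products over a noncommutative ring

Right modules over `R` are modules over `Rᵐᵒᵖ`; thus `m r` is written `op r • m`. -/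

section TensorProduct

/-- The subgroup of `M ⊗[ℤ] N` generated by the elements `m r ⊗ n - m ⊗ r n`. -/
def balancedRel (R M N : Type*) [Ring R] [AddCommGroup M] [AddCommGroup N]
    [Module Rᵐᵒᵖ M] [Module R N] : AddSubgroup (TensorProduct ℤ M N) :=
  AddSubgroup.closure {z | ∃ (r : R) (m : M) (n : N),
    z = TensorProduct.tmul ℤ (op r • m) n - TensorProduct.tmul ℤ m (r • n)}

/-- The tensor product `M ⊗_R N` of a right `R`-module `M` and a left `R`-module `N`. -/
def BTensor (R M N : Type*) [Ring R] [AddCommGroup M] [AddCommGroup N]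
    [Module Rᵐᵒᵖ M] [Module R N] : Type _ :=
  TensorProduct ℤ M N ⧸ balancedRel R M N

namespace BTensor

variable {R S M N P : Type*} [Ring R] [Ring S] [AddCommGroup M] [AddCommGroup N] [AddCommGroup P]
  [Module Rᵐᵒᵖ M] [Module R N]

instance : AddCommGroup (BTensor R M N) :=
  inferInstanceAs (AddCommGroup (TensorProduct ℤ M N ⧸ balancedRel R M N))

variable (R) in
/-- The pure tensor `m ⊗_R n`. -/
def tmul (m : M) (n : N) : BTensor R M N :=
  QuotientAddGroup.mk' (balancedRel R M N) (TensorProduct.tmul ℤ m n)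

theorem add_tmul (m m' : M) (n : N) : tmul R (m + m') n = tmul R m n + tmul R m' n := by
  simp only [tmul, TensorProduct.add_tmul]; exact map_add _ _ _

theorem tmul_add (m : M) (n n' : N) : tmul R m (n + n') = tmul R m n + tmul R m n' := by
  simp only [tmul, TensorProduct.tmul_add]; exact map_add _ _ _

theorem smul_tmul (r : R) (m : M) (n : N) : tmul R (op r • m) n = tmul R m (r • n) := by
  refine (QuotientAddGroup.eq_iff_sub_mem).2 ?_
  exact AddSubgroup.subset_closure ⟨r, m, n, rfl⟩

/-- The additive map out of `M ⊗_R N` given by a biadditive `R`-balanced map. -/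
def lift (f : M → N → P) (h₁ : ∀ m m' n, f (m + m') n = f m n + f m' n)
    (h₂ : ∀ m n n', f m (n + n') = f m n + f m n')
    (h₃ : ∀ (r : R) m n, f (op r • m) n = f m (r • n)) : BTensor R M N →+ P :=
  QuotientAddGroup.lift (balancedRel R M N)
    (TensorProduct.liftAddHom
      (AddMonoidHom.mk' (fun m => AddMonoidHom.mk' (f m) (h₂ m))
        (fun m m' => by ext n; exact h₁ m m' n))
      (fun z m n => by
        rw [map_zsmul, AddMonoidHom.zsmul_apply, map_zsmul]))
    (by
      refine (AddSubgroup.closure_le _).2 ?_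
      rintro _ ⟨r, m, n, rfl⟩
      refine (map_sub _ _ _).trans (sub_eq_zero.2 ?_)
      exact h₃ r m n)

@[simp] theorem lift_tmul (f : M → N → P) (h₁ h₂) (h₃ : ∀ (r : R) m n, f (op r • m) n = f m (r • n))
    (m : M) (n : N) : lift f h₁ h₂ h₃ (tmul R m n) = f m n := rfl

@[elab_as_elim]
theorem induction_on {p : BTensor R M N → Prop} (z : BTensor R M N)
    (tmul : ∀ m n, p (tmul R m n)) (add : ∀ x y, p x → p y → p (x + y)) : p z := by
  induction z using QuotientAddGroup.induction_on with
  | H z =>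
    induction z using TensorProduct.induction_on with
    | zero =>
      have h := tmul 0 0
      simp only [BTensor.tmul, TensorProduct.zero_tmul] at h
      exact h
    | tmul m n => exact tmul m n
    | add x y hx hy => exact add _ _ hx hy

theorem addHom_ext {f g : BTensor R M N →+ P} (h : ∀ m n, f (tmul R m n) = g (tmul R m n)) :
    f = g := by
  ext z
  induction z using induction_on with
  | tmul m n => exact h m n
  | add x y hx hy => rw [map_add, map_add, hx, hy]

theorem eq_of_tmul (f g : BTensor R M N → P)
    (hf : ∀ x y, f (x + y) = f x + f y) (hg : ∀ x y, g (x + y) = g x + g y)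
    (h : ∀ m n, f (tmul R m n) = g (tmul R m n)) (z : BTensor R M N) : f z = g z := by
  induction z using induction_on with
  | tmul m n => exact h m n
  | add x y hx hy => rw [hf, hg, hx, hy]

section Map

variable {M' N' M'' N'' : Type*} [AddCommGroup M'] [AddCommGroup N'] [AddCommGroup M'']
  [AddCommGroup N''] [Module Rᵐᵒᵖ M'] [Module R N'] [Module Rᵐᵒᵖ M''] [Module R N'']

/-- The map `f ⊗_R g`. -/
def map (f : M →ₗ[Rᵐᵒᵖ] M') (g : N →ₗ[R] N') : BTensor R M N →+ BTensor R M' N' :=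
  lift (fun m n => tmul R (f m) (g n)) (fun m m' n => by rw [map_add, add_tmul])
    (fun m n n' => by rw [map_add, tmul_add]) (fun r m n => by rw [map_smul, map_smul, smul_tmul])

@[simp] theorem map_tmul (f : M →ₗ[Rᵐᵒᵖ] M') (g : N →ₗ[R] N') (m : M) (n : N) :
    map f g (tmul R m n) = tmul R (f m) (g n) := rfl

theorem map_map (f : M →ₗ[Rᵐᵒᵖ] M') (g : N →ₗ[R] N') (f' : M' →ₗ[Rᵐᵒᵖ] M'') (g' : N' →ₗ[R] N'')
    (z : BTensor R M N) : map f' g' (map f g z) = map (f'.comp f) (g'.comp g) z := by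
  induction z using induction_on with
  | tmul m n => rfl
  | add x y hx hy => simp only [map_add, hx, hy]

theorem map_id (z : BTensor R M N) :
    map (LinearMap.id : M →ₗ[Rᵐᵒᵖ] M) (LinearMap.id : N →ₗ[R] N) z = z := by
  induction z using induction_on with
  | tmul m n => rfl
  | add x y hx hy => simp only [map_add, hx, hy]

theorem map_add_left (f f' : M →ₗ[Rᵐᵒᵖ] M') (g : N →ₗ[R] N') (z : BTensor R M N) :
    map (f + f') g z = map f g z + map f' g z := by
  induction z using induction_on with
  | tmul m n => simp only [map_tmul, LinearMap.add_apply, add_tmul]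
  | add x y hx hy => rw [map_add, map_add, map_add, hx, hy]; abel

theorem map_zero_left (g : N →ₗ[R] N') (z : BTensor R M N) :
    map (0 : M →ₗ[Rᵐᵒᵖ] M') g z = 0 := by
  have h := map_add_left (0 : M →ₗ[Rᵐᵒᵖ] M') 0 g z
  rwa [add_zero, left_eq_add] at h

theorem map_neg_left (f : M →ₗ[Rᵐᵒᵖ] M') (g : N →ₗ[R] N') (z : BTensor R M N) :
    map (-f) g z = -map f g z := by
  rw [eq_neg_iff_add_eq_zero, ← map_add_left, neg_add_cancel, map_zero_left]

end Map

/-- `s (m ⊗ n) = (s m) ⊗ n` for an `S`-`R` bimodule `M`. -/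
instance leftModule [Module S M] [SMulCommClass S Rᵐᵒᵖ M] : Module S (BTensor R M N) where
  smul s := lift (fun m n => tmul R (s • m) n) (fun m m' n => by rw [smul_add, add_tmul])
    (fun m n n' => tmul_add _ _ _) (fun r m n => by rw [smul_comm, smul_tmul])
  one_smul z := by
    induction z using induction_on with
    | tmul m n => exact congrArg (fun x => tmul R x n) (one_smul S m)
    | add x y hx hy => exact (map_add _ _ _).trans (congrArg₂ _ hx hy)
  mul_smul s t z := by
    induction z using induction_on with
    | tmul m n => exact congrArg (fun x => tmul R x n) (mul_smul s t m)
    | add x y hx hy =>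
      refine (map_add _ _ _).trans ((congrArg₂ _ hx hy).trans ?_)
      exact ((congrArg _ (map_add _ _ _)).trans (map_add _ _ _)).symm
  smul_zero s := map_zero _
  smul_add s := map_add _
  add_smul s t z := by
    induction z using induction_on with
    | tmul m n => exact (congrArg (fun x => tmul R x n) (add_smul s t m)).trans (add_tmul _ _ _)
    | add x y hx hy =>
      refine (map_add _ _ _).trans ((congrArg₂ _ hx hy).trans ?_)
      refine (add_add_add_comm _ _ _ _).trans ?_
      exact (congrArg₂ _ (map_add _ _ _) (map_add _ _ _)).symm
  zero_smul z := by
    induction z using induction_on with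
    | tmul m n =>
      refine (congrArg (fun x => tmul R x n) (zero_smul S m)).trans ?_
      have h := add_tmul (R := R) (0 : M) 0 n
      rwa [add_zero, left_eq_add] at h
    | add x y hx hy => exact (map_add _ _ _).trans ((congrArg₂ _ hx hy).trans (add_zero 0))

/-- `(m ⊗ n) s = m ⊗ (n s)` for an `R`-`S` bimodule `N`. -/
instance rightModule [Module Sᵐᵒᵖ N] [SMulCommClass R Sᵐᵒᵖ N] :
    Module Sᵐᵒᵖ (BTensor R M N) where
  smul s := lift (fun m n => tmul R m (s • n)) (fun m m' n => add_tmul _ _ _)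
    (fun m n n' => by rw [smul_add, tmul_add]) (fun r m n => by rw [← smul_comm r s, smul_tmul])
  one_smul z := by
    induction z using induction_on with
    | tmul m n => exact congrArg (fun x => tmul R m x) (one_smul Sᵐᵒᵖ n)
    | add x y hx hy => exact (map_add _ _ _).trans (congrArg₂ _ hx hy)
  mul_smul s t z := by
    induction z using induction_on with
    | tmul m n => exact congrArg (fun x => tmul R m x) (mul_smul s t n)
    | add x y hx hy =>
      refine (map_add _ _ _).trans ((congrArg₂ _ hx hy).trans ?_)
      exact ((congrArg _ (map_add _ _ _)).trans (map_add _ _ _)).symm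
  smul_zero s := map_zero _
  smul_add s := map_add _
  add_smul s t z := by
    induction z using induction_on with
    | tmul m n => exact (congrArg (fun x => tmul R m x) (add_smul s t n)).trans (tmul_add _ _ _)
    | add x y hx hy =>
      refine (map_add _ _ _).trans ((congrArg₂ _ hx hy).trans ?_)
      refine (add_add_add_comm _ _ _ _).trans ?_
      exact (congrArg₂ _ (map_add _ _ _) (map_add _ _ _)).symm
  zero_smul z := by
    induction z using induction_on with
    | tmul m n =>
      refine (congrArg (fun x => tmul R m x) (zero_smul Sᵐᵒᵖ n)).trans ?_
      have h := tmul_add (R := R) m (0 : N) 0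
      rwa [add_zero, left_eq_add] at h
    | add x y hx hy => exact (map_add _ _ _).trans ((congrArg₂ _ hx hy).trans (add_zero 0))

@[simp] theorem smul_left [Module S M] [SMulCommClass S Rᵐᵒᵖ M] (s : S) (m : M) (n : N) :
    s • tmul R m n = tmul R (s • m) n := rfl

@[simp] theorem smul_right [Module Sᵐᵒᵖ N] [SMulCommClass R Sᵐᵒᵖ N] (s : Sᵐᵒᵖ) (m : M) (n : N) :
    s • tmul R m n = tmul R m (s • n) := rfl

instance bimodule {S' : Type*} [Ring S'] [Module S M] [SMulCommClass S Rᵐᵒᵖ M]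
    [Module S'ᵐᵒᵖ N] [SMulCommClass R S'ᵐᵒᵖ N] : SMulCommClass S S'ᵐᵒᵖ (BTensor R M N) where
  smul_comm s t z := by
    induction z using induction_on with
    | tmul m n => rfl
    | add x y hx hy => simp only [smul_add, hx, hy]

/-- `M ⊗_R N → M`, `m ⊗ n ↦ m f(n)`, for a left linear form `f` on `N`. -/
def evalRight (f : N →ₗ[R] R) : BTensor R M N →+ M :=
  lift (fun m n => op (f n) • m) (fun m m' n => smul_add _ _ _)
    (fun m n n' => by rw [map_add, MulOpposite.op_add, add_smul])
    (fun r m n => by rw [map_smul, smul_eq_mul, op_mul, mul_smul])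

/-- `M ⊗_R N → N`, `m ⊗ n ↦ f(m) n`, for a right linear form `f` on `M`. -/
def evalLeft (f : M →ₗ[Rᵐᵒᵖ] R) : BTensor R M N →+ N :=
  lift (fun m n => f m • n) (fun m m' n => by rw [map_add, add_smul])
    (fun m n n' => smul_add _ _ _)
    (fun r m n => by rw [map_smul, op_smul_eq_mul, mul_smul])

@[simp] theorem evalRight_tmul (f : N →ₗ[R] R) (m : M) (n : N) :
    evalRight f (tmul R m n) = op (f n) • m := rfl

@[simp] theorem evalLeft_tmul (f : M →ₗ[Rᵐᵒᵖ] R) (m : M) (n : N) :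
    evalLeft f (tmul R m n) = f m • n := rfl

section Assoc

variable {B Q : Type*} [AddCommGroup B] [AddCommGroup Q] [Module R B] [Module Sᵐᵒᵖ B] [SMulCommClass R Sᵐᵒᵖ B]
  [Module S Q]

/-- `M ⊗_R B → M ⊗_R (B ⊗_S Q)`, `m ⊗ b ↦ m ⊗ (b ⊗ p)`. -/
def insRight (p : Q) : BTensor R M B →+ BTensor R M (BTensor S B Q) :=
  lift (fun m b => tmul R m (tmul S b p)) (fun m m' b => add_tmul _ _ _)
    (fun m b b' => (congrArg (tmul R m) (add_tmul b b' p)).trans (tmul_add _ _ _))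
    (fun r m b => smul_tmul r m (tmul S b p))

/-- `B ⊗_S Q → (M ⊗_R B) ⊗_S Q`, `b ⊗ p ↦ (m ⊗ b) ⊗ p`. -/
def insLeft (m : M) : BTensor S B Q →+ BTensor S (BTensor R M B) Q :=
  lift (fun b p => tmul S (tmul R m b) p)
    (fun b b' p => (congrArg (fun x => tmul S x p) (tmul_add m b b')).trans (add_tmul _ _ _))
    (fun b p p' => tmul_add _ _ _)
    (fun s b p => smul_tmul s (tmul R m b) p)

@[simp] theorem insRight_tmul (p : Q) (m : M) (b : B) :
    insRight p (tmul R m b) = tmul R m (tmul S b p) := rfl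

@[simp] theorem insLeft_tmul (m : M) (b : B) (p : Q) :
    insLeft m (tmul S b p) = tmul S (tmul R m b) p := rfl

variable (M B Q) in
/-- `(M ⊗_R B) ⊗_S Q → M ⊗_R (B ⊗_S Q)`, `(m ⊗ b) ⊗ p ↦ m ⊗ (b ⊗ p)`. -/
def assocHom : BTensor S (BTensor R M B) Q →+ BTensor R M (BTensor S B Q) :=
  lift (fun z p => insRight p z)
    (fun z z' p => map_add (insRight p) z z')
    (fun z p p' => DFunLike.congr_fun (f := insRight (p + p')) (g := insRight p + insRight p')
      (addHom_ext fun m b =>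
        (congrArg (tmul R m) (tmul_add b p p')).trans (tmul_add m _ _)) z)
    (fun s z p => by
      induction z using induction_on with
      | tmul m b => exact congrArg (fun x => tmul R m x) (smul_tmul s b p)
      | add x y hx hy =>
        rw [smul_add, map_add (insRight p), map_add (insRight (s • p)), hx, hy])

variable (M B Q) in
/-- `M ⊗_R (B ⊗_S Q) → (M ⊗_R B) ⊗_S Q`, `m ⊗ (b ⊗ p) ↦ (m ⊗ b) ⊗ p`. -/
def assocInv : BTensor R M (BTensor S B Q) →+ BTensor S (BTensor R M B) Q :=
  lift (fun m z => insLeft m z)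
    (fun m m' z => DFunLike.congr_fun (f := insLeft (m + m')) (g := insLeft m + insLeft m')
      (addHom_ext fun b p =>
        (congrArg (fun x => tmul S x p) (add_tmul m m' b)).trans (add_tmul _ _ p)) z)
    (fun m z z' => map_add (insLeft m) z z')
    (fun r m z => by
      induction z using induction_on with
      | tmul b p => exact congrArg (fun x => tmul S x p) (smul_tmul r m b)
      | add x y hx hy =>
        rw [smul_add, map_add (insLeft m), map_add (insLeft (op r • m)), hx, hy])

@[simp] theorem assocHom_tmul (m : M) (b : B) (p : Q) :
    assocHom M B Q (tmul S (tmul R m b) p) = tmul R m (tmul S b p) := rfl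

@[simp] theorem assocInv_tmul (m : M) (b : B) (p : Q) :
    assocInv M B Q (tmul R m (tmul S b p)) = tmul S (tmul R m b) p := rfl

@[elab_as_elim]
theorem induction_left {p : BTensor S (BTensor R M B) Q → Prop} (z : BTensor S (BTensor R M B) Q)
    (tmul : ∀ m b x, p (tmul S (BTensor.tmul R m b) x)) (add : ∀ x y, p x → p y → p (x + y)) :
    p z := by
  induction z using induction_on with
  | tmul y x =>
    induction y using induction_on with
    | tmul m b => exact tmul m b x
    | add y y' h h' => rw [add_tmul]; exact add _ _ h h'
  | add x y hx hy => exact add x y hx hy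

@[elab_as_elim]
theorem induction_right {p : BTensor R M (BTensor S B Q) → Prop} (z : BTensor R M (BTensor S B Q))
    (tmul : ∀ m b x, p (tmul R m (BTensor.tmul S b x))) (add : ∀ x y, p x → p y → p (x + y)) :
    p z := by
  induction z using induction_on with
  | tmul m y =>
    induction y using induction_on with
    | tmul b x => exact tmul m b x
    | add y y' h h' => rw [tmul_add]; exact add _ _ h h'
  | add x y hx hy => exact add x y hx hy

variable (M B Q) in
/-- The associativity isomorphism `(M ⊗_R B) ⊗_S Q ≅ M ⊗_R (B ⊗_S Q)`. -/
def assoc : BTensor S (BTensor R M B) Q ≃+ BTensor R M (BTensor S B Q) where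
  toFun := assocHom M B Q
  invFun := assocInv M B Q
  left_inv z := by
    induction z using induction_left with
    | tmul m b x => rfl
    | add x y hx hy => simp only [map_add, hx, hy]
  right_inv z := by
    induction z using induction_right with
    | tmul m b x => rfl
    | add x y hx hy => simp only [map_add, hx, hy]
  map_add' := map_add _

@[simp] theorem assoc_tmul (m : M) (b : B) (p : Q) :
    assoc M B Q (tmul S (tmul R m b) p) = tmul R m (tmul S b p) := rfl

@[simp] theorem assoc_symm_tmul (m : M) (b : B) (p : Q) :
    (assoc M B Q).symm (tmul R m (tmul S b p)) = tmul S (tmul R m b) p := rfl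

end Assoc

end BTensor

end TensorProduct

/-! ### Corings and their right comodules -/

/-- A coring over the ring `A`: a comonoid in the monoidal category of `A`-`A` bimodules. -/
structure Coring (A : Type u) [Ring A] where
  carrier : Type u
  [addCommGroup : AddCommGroup carrier]
  [leftModule : Module A carrier]
  [rightModule : Module Aᵐᵒᵖ carrier]
  [smulCommClass : SMulCommClass A Aᵐᵒᵖ carrier]
  /-- The coproduct `Δ`. -/
  comul : carrier →ₗ[A] BTensor A carrier carrier
  comul_op_smul : ∀ (a : A) (c : carrier), comul (op a • c) = op a • comul c
  /-- The counit `ε`. -/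
  counit : carrier →ₗ[A] A
  counit_op_smul : ∀ (a : A) (c : carrier), counit (op a • c) = counit c * a
  coassoc : ∀ c, BTensor.assoc carrier carrier carrier
    (BTensor.map ⟨⟨comul, map_add comul⟩, fun a c => comul_op_smul a.unop c⟩ LinearMap.id
      (comul c)) = BTensor.map LinearMap.id comul (comul c)
  evalLeft_counit : ∀ c, BTensor.evalLeft
    (⟨⟨counit, map_add counit⟩, fun a c => counit_op_smul a.unop c⟩ : carrier →ₗ[Aᵐᵒᵖ] A)
    (comul c) = c
  evalRight_counit : ∀ c, BTensor.evalRight counit (comul c) = c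

namespace Coring

instance (A : Type u) [Ring A] : CoeSort (Coring A) (Type u) := ⟨carrier⟩

attribute [instance] addCommGroup leftModule rightModule smulCommClass

variable {A : Type u} [Ring A] (C : Coring A)

/-- The coproduct as a map of right modules. -/
def comulR : C →ₗ[Aᵐᵒᵖ] BTensor A C C :=
  ⟨⟨C.comul, map_add C.comul⟩, fun a c => C.comul_op_smul a.unop c⟩

/-- The counit as a map of right modules. -/
def counitR : C →ₗ[Aᵐᵒᵖ] A :=
  ⟨⟨C.counit, map_add C.counit⟩, fun a c => C.counit_op_smul a.unop c⟩

@[simp] theorem comulR_apply (c : C) : C.comulR c = C.comul c := rfl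

@[simp] theorem counitR_apply (c : C) : C.counitR c = C.counit c := rfl

end Coring

/-- A right comodule `(M, ϱ)` of the `A`-coring `C`. -/
structure Comod {A : Type u} [Ring A] (C : Coring A) where
  carrier : Type u
  [addCommGroup : AddCommGroup carrier]
  [rightModule : Module Aᵐᵒᵖ carrier]
  /-- The coaction `ϱ`. -/
  coact : carrier →ₗ[Aᵐᵒᵖ] BTensor A carrier C
  coassoc : ∀ m, BTensor.assoc carrier C C (BTensor.map coact LinearMap.id (coact m)) =
    BTensor.map LinearMap.id C.comul (coact m)
  evalRight_counit : ∀ m, BTensor.evalRight C.counit (coact m) = m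

namespace Comod

variable {A : Type u} [Ring A] {C : Coring A}

instance : CoeSort (Comod C) (Type u) := ⟨carrier⟩

attribute [instance] addCommGroup rightModule

/-- A morphism of right `C`-comodules: a right `A`-linear map that commutes with the coactions. -/
@[ext]
structure Hom (M N : Comod C) where
  toLin : M →ₗ[Aᵐᵒᵖ] N
  comm : ∀ m, BTensor.map toLin LinearMap.id (M.coact m) = N.coact (toLin m)

/-- The category of right `C`-comodules. -/
instance : Category (Comod C) where
  Hom := Hom
  id M := ⟨LinearMap.id, fun m => BTensor.map_id _⟩
  comp f g := ⟨g.toLin.comp f.toLin, fun m => by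
    rw [LinearMap.comp_apply, ← g.comm, ← f.comm, BTensor.map_map]; rfl⟩

/-- The right `A`-linear map underlying a morphism of comodules. -/
def lin {M N : Comod C} (f : M ⟶ N) : M →ₗ[Aᵐᵒᵖ] N := Hom.toLin f

/-- The morphism of comodules given by a colinear map. -/
def ofLin {M N : Comod C} (f : M →ₗ[Aᵐᵒᵖ] N)
    (hf : ∀ m, BTensor.map f LinearMap.id (M.coact m) = N.coact (f m)) : M ⟶ N := ⟨f, hf⟩

variable {M N P : Comod C}

theorem lin_comm (f : M ⟶ N) (m : M) :
    BTensor.map (lin f) LinearMap.id (M.coact m) = N.coact (lin f m) := Hom.comm f m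

@[simp] theorem lin_ofLin (f : M →ₗ[Aᵐᵒᵖ] N) (hf) : lin (ofLin f hf : M ⟶ N) = f := rfl

@[simp] theorem lin_id : lin (𝟙 M) = LinearMap.id := rfl

@[simp] theorem lin_comp (f : M ⟶ N) (g : N ⟶ P) : lin (f ≫ g) = (lin g).comp (lin f) := rfl

theorem lin_injective : Function.Injective (lin : (M ⟶ N) → (M →ₗ[Aᵐᵒᵖ] N)) :=
  fun _ _ h => Hom.ext h

theorem hom_ext {f g : M ⟶ N} (h : ∀ m, lin f m = lin g m) : f = g :=
  lin_injective (LinearMap.ext h)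

/-- The colinear maps as a subgroup of the right `A`-linear maps. -/
def colin (M N : Comod C) : AddSubgroup (M →ₗ[Aᵐᵒᵖ] N) where
  carrier := {f | ∀ m, BTensor.map f LinearMap.id (M.coact m) = N.coact (f m)}
  add_mem' {f g} hf hg m := by
    rw [BTensor.map_add_left, hf m, hg m, LinearMap.add_apply, map_add]
  zero_mem' m := by rw [BTensor.map_zero_left, LinearMap.zero_apply, map_zero]
  neg_mem' {f} hf m := by rw [BTensor.map_neg_left, hf m, LinearMap.neg_apply, map_neg]

/-- Colinear maps are added pointwise. -/
instance : AddCommGroup (M ⟶ N) :=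
  Equiv.addCommGroup (β := colin M N)
    ⟨fun f => ⟨lin f, lin_comm f⟩, fun f => ofLin f.1 f.2, fun _ => rfl, fun _ => rfl⟩

@[simp] theorem lin_add (f g : M ⟶ N) : lin (f + g) = lin f + lin g := rfl

@[simp] theorem lin_zero : lin (0 : M ⟶ N) = 0 := rfl

instance : Preadditive (Comod C) where
  add_comp _ _ _ f g h := hom_ext fun m => by
    simp only [lin_comp, lin_add, LinearMap.comp_apply, LinearMap.add_apply, map_add]
  comp_add _ _ _ f g h := rfl

/-- `T = End^C(M)` acts on `M` from the left; the product of `T` is the composition of maps. -/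
instance endModule (M : Comod C) : Module (End M) M where
  smul t m := lin (t : M ⟶ M) m
  one_smul m := rfl
  mul_smul s t m := rfl
  smul_zero t := map_zero (lin (t : M ⟶ M))
  smul_add t := map_add (lin (t : M ⟶ M))
  add_smul s t m := rfl
  zero_smul m := rfl

theorem end_smul_def (t : End M) (m : M) : t • m = lin (t : M ⟶ M) m := rfl

instance (M : Comod C) : SMulCommClass (End M) Aᵐᵒᵖ M where
  smul_comm t a m := map_smul (lin (t : M ⟶ M)) a m

/-- `Hom_A(M, X)` is a right `End^C(M)`-module through composition, `(φ t)(m) = φ(t(m))`. -/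
instance homModule (M : Comod C) (X : Type*) [AddCommGroup X] [Module Aᵐᵒᵖ X] :
    Module (End M)ᵐᵒᵖ (M →ₗ[Aᵐᵒᵖ] X) where
  smul t φ := φ.comp (lin (t.unop : M ⟶ M))
  one_smul φ := rfl
  mul_smul s t φ := rfl
  smul_zero t := rfl
  smul_add t φ ψ := rfl
  add_smul s t φ := LinearMap.ext fun m => map_add φ (lin s.unop m) (lin t.unop m)
  zero_smul φ := LinearMap.ext fun m => map_zero φ

theorem op_smul_hom_apply {X : Type*} [AddCommGroup X] [Module Aᵐᵒᵖ X] (t : End M)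
    (φ : M →ₗ[Aᵐᵒᵖ] X) (m : M) : (op t • φ) m = φ (lin (t : M ⟶ M) m) := rfl

/-- The functor `Hom^C(S, -)` from right `C`-comodules to right modules over `T = End^C(S)`,
where `T` acts by `(φ t)(x) = φ(t(x))`. -/
abbrev homFunctor (S : Comod C) : Comod C ⥤ ModuleCat.{u} (End S)ᵐᵒᵖ :=
  preadditiveCoyonedaObj S

end Comod

namespace BTensor

variable {R S : Type*} [Ring R] [Ring S] {M M' B Q Q' : Type*}
  [AddCommGroup M] [AddCommGroup M'] [AddCommGroup B] [AddCommGroup Q] [AddCommGroup Q']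
  [Module Rᵐᵒᵖ M] [Module Rᵐᵒᵖ M'] [Module R B] [Module Sᵐᵒᵖ B] [SMulCommClass R Sᵐᵒᵖ B]
  [Module S Q] [Module S Q']

variable (S B) in
/-- `f ⊗_R B` as a map of right `S`-modules. -/
def mapR (f : M →ₗ[Rᵐᵒᵖ] M') : BTensor R M B →ₗ[Sᵐᵒᵖ] BTensor R M' B :=
  ⟨⟨map f LinearMap.id, (map f LinearMap.id).map_add⟩, fun s z => by
    induction z using induction_on with
    | tmul m b => rfl
    | add x y hx hy =>
      simp only [RingHom.id_apply] at hx hy ⊢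
      rw [smul_add, AddMonoidHom.map_add, hx, hy, AddMonoidHom.map_add, smul_add]⟩

variable (R B) in
/-- `B ⊗_S g` as a map of left `R`-modules. -/
def mapL (g : Q →ₗ[S] Q') : BTensor S B Q →ₗ[R] BTensor S B Q' :=
  ⟨⟨map LinearMap.id g, (map LinearMap.id g).map_add⟩, fun s z => by
    induction z using induction_on with
    | tmul m b => rfl
    | add x y hx hy =>
      simp only [RingHom.id_apply] at hx hy ⊢
      rw [smul_add, AddMonoidHom.map_add, hx, hy, AddMonoidHom.map_add, smul_add]⟩

@[simp] theorem mapR_apply (f : M →ₗ[Rᵐᵒᵖ] M') (z : BTensor R M B) :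
    mapR S B f z = map f LinearMap.id z := rfl

@[simp] theorem mapL_apply (g : Q →ₗ[S] Q') (z : BTensor S B Q) :
    mapL R B g z = map LinearMap.id g z := rfl

theorem assoc_map (f : M →ₗ[Rᵐᵒᵖ] M') (g : Q →ₗ[S] Q') (z : BTensor S (BTensor R M B) Q) :
    assoc M' B Q' (map (mapR S B f) g z) = map f (mapL R B g) (assoc M B Q z) := by
  induction z using induction_left with
  | tmul m b q => rfl
  | add x y hx hy => rw [AddMonoidHom.map_add, map_add, map_add, AddMonoidHom.map_add, hx, hy]

theorem mapL_id : mapL R B (LinearMap.id : Q →ₗ[S] Q) = LinearMap.id :=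
  LinearMap.ext fun z => map_id z

end BTensor

namespace Comod

variable {A : Type u} [Ring A] {C : Coring A}

/-- The coaction of `S` is left linear over `End^C(S)`. -/
def coactL (S : Comod C) : S →ₗ[End S] BTensor A S C :=
  ⟨⟨S.coact, map_add S.coact⟩, fun t x => by
    have key : ∀ z : BTensor A S C, BTensor.map (lin (t : S ⟶ S)) LinearMap.id z = t • z := by
      intro z
      induction z using BTensor.induction_on with
      | tmul m c => rfl
      | add x y hx hy => rw [AddMonoidHom.map_add, hx, hy, smul_add]
    exact (lin_comm (t : S ⟶ S) x).symm.trans (key _)⟩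

section Ind

variable (S : Comod C) (W : Type u) [AddCommGroup W] [Module (End S)ᵐᵒᵖ W]

/-- The right `A`-linear map `S → W ⊗_T S`, `x ↦ w ⊗ x`. -/
def insW (w : W) : S →ₗ[Aᵐᵒᵖ] BTensor (End S) W S where
  toFun x := BTensor.tmul (End S) w x
  map_add' x y := BTensor.tmul_add w x y
  map_smul' a x := rfl

/-- The coaction `w ⊗ x ↦ (w ⊗ x^{[0]}) ⊗ x^{[1]}` on `W ⊗_T S`. -/
def indCoact : BTensor (End S) W S →ₗ[Aᵐᵒᵖ] BTensor A (BTensor (End S) W S) C :=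
  ⟨⟨fun z => (BTensor.assoc W S C).symm (BTensor.map LinearMap.id S.coactL z), fun z z' => by
    rw [AddMonoidHom.map_add, AddEquiv.map_add]⟩, fun a z => by
      induction z using BTensor.induction_on with
      | tmul w x =>
        have key : ∀ y : BTensor A S C, (BTensor.assoc W S C).symm (BTensor.tmul (End S) w (a • y)) =
            a • (BTensor.assoc W S C).symm (BTensor.tmul (End S) w y) := by
          intro y
          induction y using BTensor.induction_on with
          | tmul m c => rfl
          | add x y hx hy =>
            rw [smul_add, BTensor.tmul_add, BTensor.tmul_add, AddEquiv.map_add, AddEquiv.map_add,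
              smul_add, hx, hy]
        refine Eq.trans ?_ (key (S.coact x))
        exact congrArg (fun y => (BTensor.assoc W S C).symm (BTensor.tmul (End S) w y))
          (map_smul S.coact a x)
      | add x y hx hy =>
        simp only [RingHom.id_apply] at hx hy ⊢
        rw [smul_add, AddMonoidHom.map_add, AddEquiv.map_add, hx, hy, AddMonoidHom.map_add,
          AddEquiv.map_add, smul_add]⟩

theorem indCoact_tmul (w : W) (x : S) :
    indCoact S W (BTensor.tmul (End S) w x) =
      BTensor.map (insW S W w) LinearMap.id (S.coact x) := by
  have key : ∀ y : BTensor A S C, (BTensor.assoc W S C).symm (BTensor.tmul (End S) w y) =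
      BTensor.map (insW S W w) LinearMap.id y := by
    intro y
    induction y using BTensor.induction_on with
    | tmul m c => rfl
    | add x y hx hy => rw [BTensor.tmul_add, AddEquiv.map_add, AddMonoidHom.map_add, hx, hy]
  exact key _

/-- The right `C`-comodule `W ⊗_T S`, for a right module `W` over `T = End^C(S)`. -/
def indObj : Comod C where
  carrier := BTensor (End S) W S
  coact := indCoact S W
  coassoc z := by
    induction z using BTensor.induction_on with
    | tmul w x =>
      have h : (indCoact S W).comp (insW S W w) =
          (BTensor.mapR A C (insW S W w)).comp S.coact :=
        LinearMap.ext fun x => indCoact_tmul S W w x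
      rw [indCoact_tmul, BTensor.map_map, BTensor.map_map, h, LinearMap.comp_id,
        ← LinearMap.comp_id (LinearMap.id : C →ₗ[A] C), ← BTensor.map_map, BTensor.assoc_map,
        S.coassoc, BTensor.mapL_id, BTensor.map_map]
      rfl
    | add x y hx hy => simp only [map_add, hx, hy]
  evalRight_counit z := by
    induction z using BTensor.induction_on with
    | tmul w x =>
      have key : ∀ y : BTensor A S C, BTensor.evalRight C.counit
          (BTensor.map (insW S W w) LinearMap.id y) =
            BTensor.tmul (End S) w (BTensor.evalRight C.counit y) := by
        intro y
        induction y using BTensor.induction_on with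
        | tmul m c => rfl
        | add x y hx hy => rw [map_add, map_add, map_add, BTensor.tmul_add, hx, hy]
      rw [indCoact_tmul, key, S.evalRight_counit]
    | add x y hx hy => simp only [map_add, hx, hy]

end Ind

/-- The functor `- ⊗_T S` from right modules over `T = End^C(S)` to right `C`-comodules. -/
def indFunctor (S : Comod C) : ModuleCat.{u} (End S)ᵐᵒᵖ ⥤ Comod C where
  obj W := indObj S W
  map {W W'} f := ofLin (M := indObj S W) (N := indObj S W') (BTensor.mapR A S f.hom) <|
    BTensor.eq_of_tmul _ _
      (fun x y => (congrArg _ (map_add (indCoact S W) x y)).trans (map_add _ _ _))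
      (fun x y => (congrArg _ (map_add (BTensor.mapR A S f.hom) x y)).trans
        (map_add (indCoact S W') _ _))
      (fun w x => by
        refine (congrArg _ (indCoact_tmul S W w x)).trans ?_
        exact (BTensor.map_map _ _ _ _ _).trans (indCoact_tmul S W' (f.hom w) x).symm)
  map_id W := hom_ext (BTensor.map_id (M := W) (N := S))
  map_comp f g := hom_ext fun z =>
    (BTensor.map_map f.hom LinearMap.id g.hom (LinearMap.id : S →ₗ[End S] S) z).symm

/-- The map `Hom^C(S, M) ⊗_T S → M`, `φ ⊗ x ↦ φ(x)`. -/
def evAdd (S M : Comod C) : BTensor (End S) (S ⟶ M) S →+ M :=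
  BTensor.lift (fun (φ : S ⟶ M) x => lin φ x)
    (fun φ ψ x => rfl) (fun φ x y => map_add (lin φ) x y) (fun t φ x => rfl)

/-- The map `Hom^C(S, M) ⊗_T S → M`, `φ ⊗ x ↦ φ(x)`, is right `A`-linear. -/
def evLin (S M : Comod C) : BTensor (End S) (S ⟶ M) S →ₗ[Aᵐᵒᵖ] M where
  toFun := evAdd S M
  map_add' := (evAdd S M).map_add
  map_smul' a := BTensor.eq_of_tmul (fun z => evAdd S M (a • z)) (fun z => a • evAdd S M z)
    (fun x y => (congrArg _ (smul_add a x y)).trans ((evAdd S M).map_add _ _))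
    (fun x y => (congrArg _ ((evAdd S M).map_add _ _)).trans (smul_add _ _ _))
    (fun φ x => map_smul (lin φ) a x)

/-- The evaluation map `Hom^C(S, M) ⊗_T S → M`, `φ ⊗ x ↦ φ(x)`, as a morphism of comodules. -/
def ev (S M : Comod C) : (indFunctor S).obj ((homFunctor S).obj M) ⟶ M :=
  ofLin (M := indObj S (S ⟶ M)) (evLin S M) <|
    BTensor.eq_of_tmul _ _
      (fun x y => (congrArg _ (map_add (indCoact S (S ⟶ M)) x y)).trans (map_add _ _ _))
      (fun x y => (congrArg _ (map_add (evLin S M) x y)).trans (map_add M.coact _ _))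
      (fun φ x => by
        refine (congrArg _ (indCoact_tmul S (S ⟶ M) φ x)).trans ?_
        exact (BTensor.map_map _ _ _ _ _).trans (lin_comm φ x))

theorem ev_tmul (S M : Comod C) (φ : S ⟶ M) (x : S) :
    lin (ev S M) (BTensor.tmul (End S) (M := (homFunctor S).obj M) φ x) = lin φ x := rfl

/-- The adjunction between `- ⊗_T S` and `Hom^C(S, -)`, with unit `w ↦ (x ↦ w ⊗ x)` and counit
`φ ⊗ x ↦ φ(x)`. -/
def indAdj (S : Comod C) : indFunctor S ⊣ homFunctor S :=
  Adjunction.mkOfUnitCounit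
    { unit :=
        { app W := ModuleCat.ofHom
            { toFun w := (ofLin (insW S W w) fun x => (indCoact_tmul S W w x).symm :
                S ⟶ indObj S W)
              map_add' w w' := hom_ext fun x => BTensor.add_tmul w w' x
              map_smul' t w := hom_ext fun x => BTensor.smul_tmul t.unop w x }
          naturality W W' f := by ext w; rfl }
      counit :=
        { app M := ev S M
          naturality M N f := hom_ext <| BTensor.eq_of_tmul _ _
            (map_add (lin ((homFunctor S ⋙ indFunctor S).map f ≫ ev S N)))
            (map_add (lin (ev S M ≫ f))) (fun φ x => rfl) }
      left_triangle := by
        ext W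
        exact hom_ext <| BTensor.eq_of_tmul _ _ (fun x y => map_add (lin _) x y)
          (fun x y => rfl) (fun w x => rfl)
      right_triangle := by
        ext M φ
        rfl }

/-- The canonical map `can_N : Hom_A(S, N) ⊗_T S → N ⊗_A C`,
`φ ⊗ x ↦ φ(x^{[0]}) ⊗ x^{[1]}`, for a right `A`-module `N`. -/
def can (S : Comod C) (N : Type u) [AddCommGroup N] [Module Aᵐᵒᵖ N] :
    BTensor (End S) (S →ₗ[Aᵐᵒᵖ] N) S →+ BTensor A N C :=
  BTensor.lift (fun φ x => BTensor.map φ LinearMap.id (S.coact x))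
    (fun φ ψ x => by
      generalize S.coact x = z
      induction z using BTensor.induction_on with
      | tmul m d => simp only [BTensor.map_tmul, LinearMap.add_apply, BTensor.add_tmul]
      | add x y hx hy => simp only [map_add, hx, hy]; abel)
    (fun φ x y => by rw [map_add, map_add])
    (fun t φ x => by
      rw [end_smul_def, ← lin_comm (t : S ⟶ S) x, BTensor.map_map]
      rfl)

/-- `S` is a Galois comodule: `can_N` is bijective for every right `A`-module `N`. -/
def IsGalois (S : Comod C) : Prop :=
  ∀ (N : Type u) [AddCommGroup N] [Module Aᵐᵒᵖ N], Function.Bijective (can S N)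

/-- The inverse of `can_N` for a Galois comodule. -/
def canInv {S : Comod C} (h : S.IsGalois) (N : Type u) [AddCommGroup N] [Module Aᵐᵒᵖ N] :
    BTensor A N C → BTensor (End S) (S →ₗ[Aᵐᵒᵖ] N) S :=
  (Equiv.ofBijective (can S N) (h N)).symm

/-- The map `Hom^C(S, M) ⊗_T S → Hom_A(S, M) ⊗_T S` induced by the inclusion
`Hom^C(S, M) ⊆ Hom_A(S, M)`. -/
def incl (S M : Comod C) :
    (indFunctor S).obj ((homFunctor S).obj M) → BTensor (End S) (S →ₗ[Aᵐᵒᵖ] M) S :=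
  BTensor.map (M := (homFunctor S).obj M)
    { toFun := fun φ : S ⟶ M => lin φ
      map_add' := fun φ ψ => rfl
      map_smul' := fun t φ => rfl } LinearMap.id

end Comod

/-! ### Right extensions of corings -/

/-- The diagram `X → Y ⇉ Z` is an equaliser. -/
def IsEqualizer {X Y Z : Type*} (f : X → Y) (g h : Y → Z) : Prop :=
  Function.Injective f ∧ ∀ y, g y = h y ↔ ∃ x, f x = y

/-- The `L`-coring `D` is a right extension of the `A`-coring `C`: the `A`-`L` bimodule `C` is a
`C`-`D` bicomodule through the regular left coaction `Δ_C` and a right coaction `τ`. -/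
structure RightExtension {A L : Type u} [Ring A] [Ring L] (C : Coring A) (D : Coring L)
    [Module Lᵐᵒᵖ C] [SMulCommClass A Lᵐᵒᵖ C] where
  comul_op_smul : ∀ (l : L) (c : C), C.comul (op l • c) = op l • C.comul c
  /-- The right `D`-coaction `τ` on `C`, which is left `A`-linear. -/
  coact : C →ₗ[A] BTensor L C D
  coact_op_smul : ∀ (l : L) (c : C), coact (op l • c) = op l • coact c
  coassoc : ∀ c : C, BTensor.assoc C D D
    (BTensor.map ⟨⟨coact, map_add coact⟩, fun l c => coact_op_smul l.unop c⟩ LinearMap.id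
      (coact c)) = BTensor.map LinearMap.id D.comul (coact c)
  evalRight_counit : ∀ c : C, BTensor.evalRight D.counit (coact c) = c
  /-- The coproduct of `C` is right `D`-colinear. -/
  comul_coact : ∀ c : C, BTensor.assoc C C D
    (BTensor.map ⟨⟨C.comul, map_add C.comul⟩, fun l c => comul_op_smul l.unop c⟩ LinearMap.id
      (coact c)) = BTensor.map LinearMap.id coact (C.comul c)

namespace RightExtension

variable {A L : Type u} [Ring A] [Ring L] {C : Coring A} {D : Coring L}
  [Module Lᵐᵒᵖ C] [SMulCommClass A Lᵐᵒᵖ C]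

/-- The coproduct of `C` as a right `L`-linear map. -/
def comulL (E : RightExtension C D) : C →ₗ[Lᵐᵒᵖ] BTensor A C C :=
  ⟨⟨C.comul, map_add C.comul⟩, fun l c => E.comul_op_smul l.unop c⟩

/-- The `D`-coaction of `C` as a right `L`-linear map. -/
def coactL (E : RightExtension C D) : C →ₗ[Lᵐᵒᵖ] BTensor L C D :=
  ⟨⟨E.coact, map_add E.coact⟩, fun l c => E.coact_op_smul l.unop c⟩

@[simp] theorem comulL_apply (E : RightExtension C D) (c : C) : E.comulL c = C.comul c := rfl

@[simp] theorem coactL_apply (E : RightExtension C D) (c : C) : E.coactL c = E.coact c := rfl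

/-- The left `A`-linear form `c ↦ ε(c l)` on `C`. -/
def counitSMul (C : Coring A) [Module Lᵐᵒᵖ C] [SMulCommClass A Lᵐᵒᵖ C] (l : Lᵐᵒᵖ) : C →ₗ[A] A where
  toFun c := C.counit (l • c)
  map_add' c d := by rw [smul_add, map_add]
  map_smul' a c := by rw [← smul_comm a l c, map_smul, RingHom.id_apply]

theorem evalRight_comul (E : RightExtension C D) (l : Lᵐᵒᵖ) (c : C) :
    BTensor.evalRight (counitSMul C l) (C.comul c) = l • c := by
  have key : ∀ z : BTensor A C C, BTensor.evalRight (counitSMul C l) z =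
      BTensor.evalRight C.counit (l • z) := BTensor.eq_of_tmul _ _
    (fun x y => map_add _ _ _) (fun x y => by rw [smul_add, map_add]) (fun _ _ => rfl)
  have h := E.comul_op_smul l.unop c
  rw [op_unop] at h
  rw [key, ← h, C.evalRight_counit]

/-- `C ⊗_A C → C`, `c ⊗ d ↦ c f(d)`, as a left `A`-linear map. -/
def evalRightL (f : C →ₗ[A] A) : BTensor A C C →ₗ[A] C where
  toFun := BTensor.evalRight f
  map_add' := map_add _
  map_smul' a := BTensor.eq_of_tmul _ _ (fun x y => by rw [smul_add, map_add])
    (fun x y => by rw [map_add, smul_add]) (fun c d => (smul_comm a (op (f d)) c).symm)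

@[simp] theorem evalRightL_apply (f : C →ₗ[A] A) (z : BTensor A C C) :
    evalRightL f z = BTensor.evalRight f z := rfl

/-- `ϱ(m^{[0]} f(m^{[1]})) = m^{[0]} ⊗ m^{[1](1)} f(m^{[1](2)})`. -/
theorem coact_evalRight (M : Comod C) (f : C →ₗ[A] A) (m : M) :
    M.coact (BTensor.evalRight f (M.coact m)) =
      BTensor.map LinearMap.id ((evalRightL f).comp C.comul) (M.coact m) := by
  have key₁ : ∀ z : BTensor A (BTensor A M C) C,
      BTensor.map LinearMap.id (evalRightL f) (BTensor.assoc M C C z) = BTensor.evalRight f z := by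
    intro z
    induction z using BTensor.induction_left with
    | tmul m c d => rfl
    | add x y hx hy => simp only [map_add, hx, hy]
  have key₂ : ∀ z : BTensor A M C, M.coact (BTensor.evalRight f z) =
      BTensor.evalRight f (BTensor.map M.coact LinearMap.id z) := BTensor.eq_of_tmul _ _
    (fun x y => by rw [map_add, map_add]) (fun x y => by rw [map_add, map_add])
    (fun m c => map_smul M.coact _ _)
  rw [key₂, ← key₁, M.coassoc, BTensor.map_map, LinearMap.id_comp]

/-- The abelian group underlying a right `C`-comodule `M`, regarded as a right `L`-module via
`m l = m^{[0]} ε_C(m^{[1]} l)`. -/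
def Res (_E : RightExtension C D) (M : Comod C) : Type u := M

instance (E : RightExtension C D) (M : Comod C) : AddCommGroup (E.Res M) := inferInstanceAs (AddCommGroup M)

/-- The left `End^C(M)`-module structure of `M`. -/
instance (E : RightExtension C D) (M : Comod C) : Module (End M) (E.Res M) :=
  inferInstanceAs (Module (End M) M)

theorem coact_res (E : RightExtension C D) (M : Comod C) (l : Lᵐᵒᵖ) (m : M) :
    M.coact (BTensor.evalRight (counitSMul C l) (M.coact m)) = l • M.coact m := by
  have key : ∀ z : BTensor A M C, BTensor.map LinearMap.id
      ((evalRightL (counitSMul C l)).comp C.comul) z = l • z := BTensor.eq_of_tmul _ _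
    (fun x y => map_add _ _ _) (fun x y => smul_add _ _ _)
    (fun m c => congrArg (BTensor.tmul A m) (E.evalRight_comul l c))
  rw [coact_evalRight, key]

instance resModule (E : RightExtension C D) (M : Comod C) : Module Lᵐᵒᵖ (E.Res M) where
  smul l m := BTensor.evalRight (M := M) (counitSMul C l) (M.coact m)
  one_smul m := by
    have h : counitSMul C (1 : Lᵐᵒᵖ) = C.counit :=
      LinearMap.ext fun c => congrArg C.counit (one_smul Lᵐᵒᵖ c)
    have h' : BTensor.evalRight (M := M) (counitSMul C (1 : Lᵐᵒᵖ)) (M.coact m) = m := by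
      rw [h]
      exact M.evalRight_counit m
    exact h'
  mul_smul l l' m := by
    refine Eq.trans ?_ (congrArg (BTensor.evalRight (counitSMul C l)) (E.coact_res M l' m)).symm
    exact BTensor.eq_of_tmul (fun z => BTensor.evalRight (counitSMul C (l * l')) z)
      (fun z => BTensor.evalRight (counitSMul C l) (l' • z))
      (fun x y => map_add _ _ _) (fun x y => by rw [smul_add, map_add])
      (fun m c => congrArg (fun x => op (C.counit x) • m) (mul_smul l l' c)) (M.coact m)
  smul_zero l := by
    have h : BTensor.evalRight (M := M) (counitSMul C l) (M.coact 0) = 0 := by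
      rw [map_zero, map_zero]
    exact h
  smul_add l (m m' : M) := by
    have h : BTensor.evalRight (M := M) (counitSMul C l) (M.coact (m + m')) =
        BTensor.evalRight (counitSMul C l) (M.coact m) +
          BTensor.evalRight (counitSMul C l) (M.coact m') := by
      rw [map_add, map_add]
    exact h
  add_smul l l' m := BTensor.eq_of_tmul (fun z => BTensor.evalRight (counitSMul C (l + l')) z)
      (fun z => BTensor.evalRight (counitSMul C l) z + BTensor.evalRight (counitSMul C l') z)
      (fun x y => map_add _ _ _) (fun x y => by rw [map_add, map_add]; abel)
      (fun m c => by
        have h : C.counit ((l + l') • c) = C.counit (l • c) + C.counit (l' • c) := by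
          rw [add_smul, map_add]
        refine (congrArg (fun a => op a • m) h).trans ?_
        exact add_smul (op (C.counit (l • c))) (op (C.counit (l' • c))) m) (M.coact m)
  zero_smul m := BTensor.eq_of_tmul (fun z => BTensor.evalRight (counitSMul C (0 : Lᵐᵒᵖ)) z)
      (fun z => (0 : M)) (fun x y => map_add _ _ _) (fun x y => (add_zero 0).symm)
      (fun m c => by
        have h : C.counit ((0 : Lᵐᵒᵖ) • c) = 0 := by rw [zero_smul, map_zero]
        refine (congrArg (fun a => op a • m) h).trans ?_
        exact zero_smul Aᵐᵒᵖ m) (M.coact m)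

theorem res_smul_def (E : RightExtension C D) (M : Comod C) (l : Lᵐᵒᵖ) (m : E.Res M) :
    l • m = BTensor.evalRight (M := M) (counitSMul C l) (M.coact m) := rfl

/-- The coaction `ϱ : M → M ⊗_A C` as a right `L`-linear map. -/
def rho (E : RightExtension C D) (M : Comod C) : E.Res M →ₗ[Lᵐᵒᵖ] BTensor A M C where
  toFun m := M.coact m
  map_add' := map_add M.coact
  map_smul' l m := E.coact_res M l m

/-- `ϱ ⊗_A C : M ⊗_A C → (M ⊗_A C) ⊗_A C` as a right `L`-linear map. -/
def rhoC (_E : RightExtension C D) (M : Comod C) :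
    BTensor A M C →ₗ[Lᵐᵒᵖ] BTensor A (BTensor A M C) C :=
  BTensor.mapR L C M.coact

/-- `M ⊗_A Δ_C : M ⊗_A C → (M ⊗_A C) ⊗_A C` as a right `L`-linear map. -/
def comulM (E : RightExtension C D) (M : Comod C) : BTensor A M C →ₗ[Lᵐᵒᵖ] BTensor A (BTensor A M C) C where
  toFun z := (BTensor.assoc M C C).symm (BTensor.map LinearMap.id C.comul z)
  map_add' x y := by rw [map_add, map_add]
  map_smul' l := BTensor.eq_of_tmul _ _
    (fun x y => by rw [smul_add, map_add, map_add])
    (fun x y => by rw [map_add, map_add, smul_add])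
    (fun m c => by
      have key : ∀ z : BTensor A C C, (BTensor.assoc M C C).symm (BTensor.tmul A m (l • z)) =
          l • (BTensor.assoc M C C).symm (BTensor.tmul A m z) := BTensor.eq_of_tmul _ _
        (fun x y => by rw [smul_add, BTensor.tmul_add, map_add])
        (fun x y => by rw [BTensor.tmul_add, map_add, smul_add]) (fun c d => rfl)
      refine Eq.trans ?_ (key (C.comul c))
      exact congrArg (fun z => (BTensor.assoc M C C).symm (BTensor.tmul A m z))
        (E.comul_op_smul l.unop c))

/-- The right extension `D` of `C` is pure: for every right `C`-comodule `M`, the equaliser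
`M → M ⊗_A C ⇉ M ⊗_A C ⊗_A C` of right `L`-modules is preserved by `- ⊗_L (D ⊗_L D)`. -/
def IsPure (E : RightExtension C D) : Prop :=
  ∀ M : Comod C, IsEqualizer
    (BTensor.map (E.rho M) (LinearMap.id : BTensor L D D →ₗ[L] BTensor L D D))
    (BTensor.map (E.rhoC M) (LinearMap.id : BTensor L D D →ₗ[L] BTensor L D D))
    (BTensor.map (E.comulM M) (LinearMap.id : BTensor L D D →ₗ[L] BTensor L D D))

/-- A `D ⊗_L D`-pure equaliser is `D`-pure, since `D` is a retract of `D ⊗_L D`. -/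
theorem IsPure.isEqualizer {E : RightExtension C D} (hE : E.IsPure) (M : Comod C) : IsEqualizer
    (BTensor.map (E.rho M) (LinearMap.id : D →ₗ[L] D))
    (BTensor.map (E.rhoC M) (LinearMap.id : D →ₗ[L] D))
    (BTensor.map (E.comulM M) (LinearMap.id : D →ₗ[L] D)) := by
  let r : BTensor L D D →ₗ[L] D := evalRightL D.counit
  have hr : r.comp D.comul = LinearMap.id := LinearMap.ext D.evalRight_counit
  obtain ⟨h₁, h₂⟩ := hE M
  refine ⟨fun t t' h => ?_, fun y => ⟨fun h => ?_, ?_⟩⟩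
  · have h3 : BTensor.map LinearMap.id D.comul t = BTensor.map LinearMap.id D.comul t' := by
      apply h₁
      have := congrArg (BTensor.map LinearMap.id D.comul) h
      simpa only [BTensor.map_map, LinearMap.id_comp, LinearMap.comp_id] using this
    have := congrArg (BTensor.map LinearMap.id r) h3
    simpa only [BTensor.map_map, LinearMap.id_comp, hr, BTensor.map_id] using this
  · have h3 := congrArg (BTensor.map LinearMap.id D.comul) h
    have h4 : BTensor.map (E.rhoC M) LinearMap.id (BTensor.map LinearMap.id D.comul y) =
        BTensor.map (E.comulM M) LinearMap.id (BTensor.map LinearMap.id D.comul y) := by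
      simpa only [BTensor.map_map, LinearMap.id_comp, LinearMap.comp_id] using h3
    obtain ⟨w, hw⟩ := (h₂ _).1 h4
    refine ⟨BTensor.map LinearMap.id r w, ?_⟩
    have := congrArg (BTensor.map LinearMap.id r) hw
    simpa only [BTensor.map_map, LinearMap.id_comp, LinearMap.comp_id, hr, BTensor.map_id]
      using this
  · rintro ⟨t, rfl⟩
    have h3 : (E.rhoC M).comp (E.rho M) = (E.comulM M).comp (E.rho M) := by
      refine LinearMap.ext fun m => ?_
      exact (AddEquiv.symm_apply_eq _).2 (M.coassoc m).symm |>.symm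
    rw [BTensor.map_map, BTensor.map_map, h3]

/-- The map `M → (M ⊗_A C) ⊗_L D`, `m ↦ (m^{[0]} ⊗ m^{[1]}_{[0]}) ⊗ m^{[1]}_{[1]}`. -/
def preCoact (E : RightExtension C D) (M : Comod C) : M →+ BTensor L (BTensor A M C) D where
  toFun m := (BTensor.assoc M C D).symm (BTensor.map LinearMap.id E.coact (M.coact m))
  map_zero' := by rw [map_zero, map_zero, map_zero]
  map_add' m m' := by rw [map_add, map_add, map_add]

theorem preCoact_apply (E : RightExtension C D) (M : Comod C) (m : M) : E.preCoact M m =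
    (BTensor.assoc M C D).symm (BTensor.map LinearMap.id E.coact (M.coact m)) := rfl

theorem rhoC_preCoact (E : RightExtension C D) (M : Comod C) (m : M) :
    BTensor.map (E.rhoC M) LinearMap.id (E.preCoact M m) =
      BTensor.map (E.comulM M) LinearMap.id (E.preCoact M m) := by
  -- both sides, re-associated, equal the image of `(ϱ ⊗ C)ϱ(m)` under `(M ⊗ C) ⊗ τ`
  apply (BTensor.assoc (BTensor A M C) C D).injective
  have h₁ : BTensor.assoc (BTensor A M C) C D
      (BTensor.map (E.rhoC M) LinearMap.id (E.preCoact M m)) =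
      BTensor.map LinearMap.id E.coact (BTensor.map M.coact LinearMap.id (M.coact m)) := by
    refine (BTensor.assoc_map M.coact LinearMap.id _).trans ?_
    rw [preCoact_apply, AddEquiv.apply_symm_apply, BTensor.mapL_id, BTensor.map_map,
      BTensor.map_map, LinearMap.id_comp, LinearMap.id_comp, LinearMap.comp_id, LinearMap.comp_id]
  have h₂ : ∀ z : BTensor A M C, BTensor.assoc (BTensor A M C) C D
      (BTensor.map (E.comulM M) LinearMap.id
        ((BTensor.assoc M C D).symm (BTensor.map LinearMap.id E.coact z))) =
      BTensor.map LinearMap.id E.coact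
        ((BTensor.assoc M C C).symm (BTensor.map LinearMap.id C.comul z)) := by
    refine BTensor.eq_of_tmul _ _ (fun x y => by simp only [map_add])
      (fun x y => by simp only [map_add]) (fun m c => ?_)
    have k₁ : ∀ y : BTensor L C D, BTensor.assoc (BTensor A M C) C D
        (BTensor.map (E.comulM M) LinearMap.id ((BTensor.assoc M C D).symm (BTensor.tmul A m y))) =
        (BTensor.assoc M C (BTensor L C D)).symm (BTensor.tmul A m
          (BTensor.assoc C C D (BTensor.map E.comulL LinearMap.id y))) := by
      refine BTensor.eq_of_tmul _ _ (fun x y => by simp only [map_add, BTensor.tmul_add])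
        (fun x y => by simp only [map_add, BTensor.tmul_add]) (fun c d => ?_)
      have k₂ : ∀ z : BTensor A C C, BTensor.assoc (BTensor A M C) C D
          (BTensor.tmul L ((BTensor.assoc M C C).symm (BTensor.tmul A m z)) d) =
          (BTensor.assoc M C (BTensor L C D)).symm (BTensor.tmul A m
            (BTensor.assoc C C D (BTensor.tmul L z d))) :=
        BTensor.eq_of_tmul _ _
          (fun x y => by simp only [map_add, BTensor.tmul_add, BTensor.add_tmul])
          (fun x y => by simp only [map_add, BTensor.tmul_add, BTensor.add_tmul])
          (fun _ _ => rfl)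
      exact k₂ (C.comul c)
    have k₃ : ∀ z : BTensor A C C, (BTensor.assoc M C (BTensor L C D)).symm (BTensor.tmul A m
        (BTensor.map LinearMap.id E.coact z)) =
        BTensor.map LinearMap.id E.coact ((BTensor.assoc M C C).symm (BTensor.tmul A m z)) :=
      BTensor.eq_of_tmul _ _ (fun x y => by simp only [map_add, BTensor.tmul_add])
        (fun x y => by simp only [map_add, BTensor.tmul_add]) (fun _ _ => rfl)
    refine (k₁ (E.coact c)).trans ((congrArg (fun z => (BTensor.assoc M C (BTensor L C D)).symm
      (BTensor.tmul A m z)) (E.comul_coact c)).trans (k₃ (C.comul c)))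
  rw [h₁, preCoact_apply, h₂, ← M.coassoc, AddEquiv.symm_apply_apply]

variable {E : RightExtension C D}

theorem IsPure.exists_tau (hE : E.IsPure) (M : Comod C) (m : M) :
    ∃ t : BTensor L (E.Res M) D, BTensor.map (E.rho M) LinearMap.id t = E.preCoact M m :=
  ((hE.isEqualizer M).2 _).1 (E.rhoC_preCoact M m)

/-- The right `D`-coaction `τ_M : M → M ⊗_L D` on a right `C`-comodule `M`: by purity, `M ⊗_L D` is
identified through `ϱ ⊗_L D` with the cotensor product of `M` and `C ⊗_L D`, and `τ_M(m)` is the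
element corresponding to `m^{[0]} ⊗ m^{[1]}_{[0]} ⊗ m^{[1]}_{[1]}`; informally,
`τ_M(m) = m^{[0]} ε_C(m^{[1]}_{[0]}) ⊗ m^{[1]}_{[1]}`. -/
def tau (hE : E.IsPure) (M : Comod C) : E.Res M →+ BTensor L (E.Res M) D where
  toFun m := (hE.exists_tau M m).choose
  map_zero' := (hE.isEqualizer M).1 <|
    (hE.exists_tau M 0).choose_spec.trans <| (map_zero _).trans (map_zero _).symm
  map_add' m m' := (hE.isEqualizer M).1 <|
    (hE.exists_tau M (m + m')).choose_spec.trans <| (map_add _ m m').trans <| Eq.symm <|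
      (map_add _ _ _).trans <|
        congrArg₂ _ (hE.exists_tau M m).choose_spec (hE.exists_tau M m').choose_spec

/-- The coaction `ϱ` is right `D`-colinear. -/
theorem map_rho_tau (hE : E.IsPure) (M : Comod C) (m : E.Res M) :
    BTensor.map (E.rho M) LinearMap.id (tau hE M m) = E.preCoact M m :=
  (hE.exists_tau M m).choose_spec

end RightExtension

/-! ### Bicomodules and the Morita context -/

/-- An `L`-`C` bicomodule: a right `C`-comodule that is a left `L`-module (and an `L`-`A` bimodule)
with a left `L`-linear `C`-coaction. -/
structure Bicomod {A : Type u} [Ring A] (L : Type u) [Ring L] (C : Coring A) extends Comod C where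
  [leftModule : Module L carrier]
  [smulCommClass : SMulCommClass L Aᵐᵒᵖ carrier]
  coact_smul : ∀ (l : L) (x : carrier), coact (l • x) = l • coact x

attribute [instance] Bicomod.leftModule Bicomod.smulCommClass

namespace Bicomod

variable {A L : Type u} [Ring A] [Ring L] {C : Coring A} (S : Bicomod L C)

instance : CoeSort (Bicomod L C) (Type u) := ⟨fun S => S.carrier⟩

/-- The algebra `T = End^C(S)`, with composition as multiplication. -/
abbrev T : Type u := End S.toComod

/-- Left multiplication by `l` as a right `A`-linear map. -/
def lmul (l : L) : S →ₗ[Aᵐᵒᵖ] S where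
  toFun x := l • x
  map_add' := smul_add l
  map_smul' a x := smul_comm l a x

/-- The unit map `L → T`, `l ↦ (x ↦ l x)` of the `L`-ring `T`. -/
def unit (l : L) : S.T :=
  Comod.ofLin (M := S.toComod) (N := S.toComod) (S.lmul l) fun x => by
    have h := BTensor.eq_of_tmul (fun z : BTensor A S C => BTensor.map (S.lmul l) LinearMap.id z)
      (fun z => l • z) (fun x y => map_add _ _ _) (fun x y => smul_add _ _ _) (fun x c => rfl)
    exact (h (S.coact x)).trans (S.coact_smul l x).symm

theorem unit_smul (l : L) (x : S) : S.unit l • x = l • x := rfl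

theorem T_ext {s t : S.T} (h : ∀ x : S, s • x = t • x) : s = t := Comod.hom_ext h

theorem unit_one : S.unit 1 = 1 := S.T_ext fun x => one_smul L x

theorem unit_add (l l' : L) : S.unit (l + l') = S.unit l + S.unit l' :=
  S.T_ext fun x => add_smul l l' x

theorem unit_mul (l l' : L) : S.unit (l * l') = S.unit l * S.unit l' :=
  S.T_ext fun x => mul_smul l l' x

/-! #### The convolution algebra `_L Hom_L(D, T)` -/

/-- The `L`-`L` bimodule maps `D → T`, where `T` is an `L`-`L` bimodule through the unit map. -/
def homLL (D : Coring L) : AddSubgroup (D →+ S.T) where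
  carrier := {v | ∀ (l : L) (d : D), v (l • d) = S.unit l * v d ∧ v (op l • d) = v d * S.unit l}
  add_mem' {v w} hv hw l d := by
    simp only [AddMonoidHom.add_apply, (hv l d).1, (hv l d).2, (hw l d).1, (hw l d).2, mul_add,
      add_mul, and_self]
  zero_mem' l d := by simp
  neg_mem' {v} hv l d := by
    simp only [AddMonoidHom.neg_apply, (hv l d).1, (hv l d).2, mul_neg, neg_mul, and_self]

section Conv

variable {S} {D : Coring L}

theorem homLL_ext {v w : S.homLL D} (h : ∀ d, v.1 d = w.1 d) : v = w :=
  Subtype.ext (AddMonoidHom.ext h)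

/-- `d ⊗ d' ↦ v(d) w(d')`. -/
def convAux (v w : S.homLL D) : BTensor L D D →+ S.T :=
  BTensor.lift (fun d d' => v.1 d * w.1 d') (fun d d' e => by rw [map_add, add_mul])
    (fun d e e' => by rw [map_add, mul_add])
    (fun l d e => by rw [(v.2 l d).2, (w.2 l e).1, mul_assoc])

/-- The convolution product `(v w)(d) = v(d_{(1)}) w(d_{(2)})`. -/
instance : Mul (S.homLL D) where
  mul v w := ⟨(convAux v w).comp (D.comul : D →+ BTensor L D D), fun l d => by
    have h₁ := BTensor.eq_of_tmul (fun z => convAux v w (l • z))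
      (fun z => S.unit l * convAux v w z) (fun x y => by rw [smul_add, map_add])
      (fun x y => by rw [map_add, mul_add])
      (fun d e => (congrArg (· * w.1 e) (v.2 l d).1).trans (mul_assoc _ _ _))
    have h₂ := BTensor.eq_of_tmul (fun z => convAux v w (op l • z))
      (fun z => convAux v w z * S.unit l) (fun x y => by rw [smul_add, map_add])
      (fun x y => by rw [map_add, add_mul])
      (fun d e => (congrArg (v.1 d * ·) (w.2 l e).2).trans (mul_assoc _ _ _).symm)
    exact ⟨(congrArg (convAux v w) (map_smul D.comul l d)).trans (h₁ _),
      (congrArg (convAux v w) (D.comul_op_smul l d)).trans (h₂ _)⟩⟩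

/-- The unit `d ↦ ε_D(d) 1_T` of the convolution product. -/
instance : One (S.homLL D) where
  one := ⟨AddMonoidHom.mk' (fun d => S.unit (D.counit d))
      (fun d e => by rw [map_add, unit_add]), fun l d =>
    ⟨by simp only [AddMonoidHom.mk'_apply, map_smul, smul_eq_mul, unit_mul],
      by simp only [AddMonoidHom.mk'_apply, D.counit_op_smul, unit_mul]⟩⟩

theorem homLL_mul_apply (v w : S.homLL D) (d : D) : (v * w).1 d = convAux v w (D.comul d) := rfl

theorem homLL_one_apply (d : D) : (1 : S.homLL D).1 d = S.unit (D.counit d) := rfl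

/-- `d ⊗ (d' ⊗ d'') ↦ u(d) (v(d') w(d''))`. -/
def convAux₃ (u v w : S.homLL D) : BTensor L D (BTensor L D D) →+ S.T :=
  BTensor.lift (fun d z => u.1 d * convAux v w z) (fun d d' e => by rw [map_add, add_mul])
    (fun d e e' => by rw [map_add, mul_add])
    (fun l d z => by
      rw [(u.2 l d).2, mul_assoc]
      refine congrArg (u.1 d * ·) ?_
      exact BTensor.eq_of_tmul (fun z => S.unit l * convAux v w z) (fun z => convAux v w (l • z))
        (fun x y => by rw [map_add, mul_add]) (fun x y => by rw [smul_add, map_add])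
        (fun d e => (mul_assoc _ _ _).symm.trans (congrArg (· * w.1 e) (v.2 l d).1.symm)) z)

theorem homLL_mul_assoc (u v w : S.homLL D) : u * v * w = u * (v * w) := by
  refine homLL_ext fun d => ?_
  have h₁ : ∀ z, convAux (u * v) w z = convAux₃ u v w
      (BTensor.assoc D D D (BTensor.map D.comulR LinearMap.id z)) :=
    BTensor.eq_of_tmul _ _ (fun x y => by rw [map_add])
      (fun x y => by rw [map_add, map_add, map_add]) fun a b =>
        BTensor.eq_of_tmul (fun y => convAux u v y * w.1 b)
          (fun y => convAux₃ u v w (BTensor.assoc D D D (BTensor.tmul L y b)))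
          (fun x y => by rw [map_add, add_mul])
          (fun x y => by rw [BTensor.add_tmul, map_add, map_add])
          (fun x y => mul_assoc _ _ _) (D.comul a)
  have h₂ : ∀ z, convAux u (v * w) z = convAux₃ u v w (BTensor.map LinearMap.id D.comul z) :=
    BTensor.eq_of_tmul _ _ (fun x y => by rw [map_add])
      (fun x y => by rw [map_add, map_add]) fun a b => rfl
  rw [homLL_mul_apply, homLL_mul_apply, h₁, h₂, ← D.coassoc]
  rfl

/-- The algebra `_L Hom_L(D, T)` with the convolution product. -/
instance : Ring (S.homLL D) :=
  { (inferInstance : AddCommGroup (S.homLL D)), (inferInstance : Mul (S.homLL D)),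
    (inferInstance : One (S.homLL D)) with
    mul_assoc := homLL_mul_assoc
    one_mul := fun v => homLL_ext fun d =>
      (BTensor.eq_of_tmul (fun z => convAux 1 v z) (fun z => v.1 (BTensor.evalLeft D.counitR z))
        (fun x y => map_add _ _ _) (fun x y => by rw [map_add, map_add])
        (fun a b => (v.2 (D.counit a) b).1.symm) (D.comul d)).trans
        (congrArg v.1 (D.evalLeft_counit d))
    mul_one := fun v => homLL_ext fun d =>
      (BTensor.eq_of_tmul (fun z => convAux v 1 z) (fun z => v.1 (BTensor.evalRight D.counit z))
        (fun x y => map_add _ _ _) (fun x y => by rw [map_add, map_add])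
        (fun a b => (v.2 (D.counit b) a).2.symm) (D.comul d)).trans
        (congrArg v.1 (D.evalRight_counit d))
    left_distrib := fun u v w => homLL_ext fun d =>
      BTensor.eq_of_tmul (fun z => convAux u (v + w) z) (fun z => convAux u v z + convAux u w z)
        (fun x y => map_add _ _ _) (fun x y => by rw [map_add, map_add]; abel)
        (fun a b => mul_add _ _ _) (D.comul d)
    right_distrib := fun u v w => homLL_ext fun d =>
      BTensor.eq_of_tmul (fun z => convAux (u + v) w z) (fun z => convAux u w z + convAux v w z)
        (fun x y => map_add _ _ _) (fun x y => by rw [map_add, map_add]; abel)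
        (fun a b => add_mul _ _ _) (D.comul d)
    zero_mul := fun v => homLL_ext fun d =>
      BTensor.eq_of_tmul (fun z => convAux 0 v z) (fun z => 0)
        (fun x y => map_add _ _ _) (fun x y => (add_zero 0).symm)
        (fun a b => zero_mul _) (D.comul d)
    mul_zero := fun v => homLL_ext fun d =>
      BTensor.eq_of_tmul (fun z => convAux v 0 z) (fun z => 0)
        (fun x y => map_add _ _ _) (fun x y => (add_zero 0).symm)
        (fun a b => mul_zero _) (D.comul d) }

end Conv

end Bicomod

namespace RightExtension

variable {A L : Type u} [Ring A] [Ring L] {C : Coring A} {D : Coring L}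
  [Module Lᵐᵒᵖ C] [SMulCommClass A Lᵐᵒᵖ C]

/-- The left `L`-module structure of an `L`-`C` bicomodule `S`. -/
instance (E : RightExtension C D) (S : Bicomod L C) : Module L (E.Res S.toComod) :=
  inferInstanceAs (Module L S)

/-- A morphism of right `C`-comodules is right `L`-linear. -/
def resMap (E : RightExtension C D) {M N : Comod C} (f : M ⟶ N) :
    E.Res M →ₗ[Lᵐᵒᵖ] E.Res N where
  toFun m := Comod.lin f m
  map_add' := map_add (Comod.lin f)
  map_smul' l (m : M) := by
    have h := BTensor.eq_of_tmul
      (fun z : BTensor A M C => Comod.lin f (BTensor.evalRight (counitSMul C l) z))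
      (fun z => BTensor.evalRight (counitSMul C l) (BTensor.map (Comod.lin f) LinearMap.id z))
      (fun x y => by rw [map_add, map_add]) (fun x y => by rw [map_add, map_add])
      (fun x c => map_smul (Comod.lin f) _ _) (M.coact m)
    exact h.trans (congrArg (BTensor.evalRight (counitSMul C l)) (Comod.lin_comm f m))

/-- A morphism of right `C`-comodules is right `D`-colinear. -/
theorem tau_resMap {E : RightExtension C D} (hE : E.IsPure) {M N : Comod C} (f : M ⟶ N)
    (m : E.Res M) :
    tau hE N (E.resMap f m) = BTensor.map (E.resMap f) LinearMap.id (tau hE M m) := by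
  apply (hE.isEqualizer N).1
  rw [map_rho_tau, BTensor.map_map]
  have h₁ : (E.rho N).comp (E.resMap f) = (BTensor.mapR L C (Comod.lin f)).comp (E.rho M) :=
    LinearMap.ext fun m => (Comod.lin_comm f m).symm
  have h₂ : ∀ m : M, BTensor.map (BTensor.mapR L C (Comod.lin f)) LinearMap.id (E.preCoact M m) =
      E.preCoact N (Comod.lin f m) := fun m => by
    apply (BTensor.assoc N C D).injective
    rw [BTensor.assoc_map, preCoact_apply, preCoact_apply, AddEquiv.apply_symm_apply,
      AddEquiv.apply_symm_apply, BTensor.mapL_id, ← Comod.lin_comm, BTensor.map_map,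
      BTensor.map_map, LinearMap.id_comp, LinearMap.id_comp, LinearMap.comp_id, LinearMap.comp_id]
  rw [h₁, LinearMap.comp_id, ← LinearMap.comp_id (LinearMap.id : D →ₗ[L] D), ← BTensor.map_map,
    map_rho_tau]
  exact (h₂ m).symm

theorem resMap_apply (E : RightExtension C D) {M : Comod C} (t : End M) (m : E.Res M) :
    E.resMap (t : M ⟶ M) m = t • m := rfl

theorem smul_op_smul (E : RightExtension C D) {M : Comod C} (t : End M) (l : Lᵐᵒᵖ) (m : E.Res M) :
    t • l • m = l • t • m := map_smul (E.resMap (t : M ⟶ M)) l m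

end RightExtension

namespace Bicomod

open RightExtension

variable {A L : Type u} [Ring A] [Ring L] {C : Coring A} {D : Coring L}
  [Module Lᵐᵒᵖ C] [SMulCommClass A Lᵐᵒᵖ C] {E : RightExtension C D} (hE : E.IsPure)
  (S : Bicomod L C)

/-! #### The left module `_L Hom^D(D, S)` -/

/-- The left `L`-linear right `D`-colinear maps `D → S`. -/
def homLD : AddSubgroup (D →ₗ[Lᵐᵒᵖ] E.Res S.toComod) where
  carrier := {p | (∀ (l : L) (d : D), p (l • d) = l • p d) ∧
    ∀ d : D, tau hE S.toComod (p d) = BTensor.map p LinearMap.id (D.comul d)}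
  add_mem' {p p'} hp hp' :=
    ⟨fun l d => by
      rw [LinearMap.add_apply, LinearMap.add_apply, hp.1, hp'.1, smul_add],
      fun d => by
        rw [LinearMap.add_apply, map_add, hp.2 d, hp'.2 d, BTensor.map_add_left]⟩
  zero_mem' := ⟨fun l d => (smul_zero l).symm,
    fun d => by rw [LinearMap.zero_apply, map_zero, BTensor.map_zero_left]⟩
  neg_mem' {p} hp :=
    ⟨fun l d => by rw [LinearMap.neg_apply, LinearMap.neg_apply, hp.1, smul_neg],
      fun d => by rw [LinearMap.neg_apply, map_neg, hp.2 d, BTensor.map_neg_left]⟩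

variable {hE S}

theorem homLD_ext {p p' : homLD hE S} (h : ∀ d, p.1 d = p'.1 d) : p = p' :=
  Subtype.ext (LinearMap.ext h)

theorem unit_smul_res (l : L) (x : E.Res S.toComod) : S.unit l • x = l • x := rfl

/-- `d ⊗ d' ↦ v(d)(p(d'))`. -/
def actAux (v : S.homLL D) (p : homLD hE S) : BTensor L D D →+ E.Res S.toComod :=
  BTensor.lift (fun d d' => v.1 d • p.1 d')
    (fun d d' e => by rw [map_add, add_smul])
    (fun d e e' => by rw [map_add, smul_add])
    (fun l d e => by rw [(v.2 l d).2, mul_smul, p.2.1, unit_smul_res])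

theorem actAux_tmul (v : S.homLL D) (p : homLD hE S) (d e : D) :
    actAux v p (BTensor.tmul L d e) = v.1 d • p.1 e := rfl

theorem actAux_op_smul (v : S.homLL D) (p : homLD hE S) (l : Lᵐᵒᵖ) (z : BTensor L D D) :
    actAux v p (l • z) = l • actAux v p z :=
  BTensor.eq_of_tmul (fun z => actAux v p (l • z)) (fun z => l • actAux v p z)
    (fun x y => by rw [smul_add, map_add]) (fun x y => by rw [map_add, smul_add])
    (fun a b => by rw [BTensor.smul_right, actAux_tmul, actAux_tmul, map_smul, smul_op_smul]) z

theorem actAux_smul (v : S.homLL D) (p : homLD hE S) (l : L) (z : BTensor L D D) :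
    actAux v p (l • z) = l • actAux v p z :=
  BTensor.eq_of_tmul (fun z => actAux v p (l • z)) (fun z => l • actAux v p z)
    (fun x y => by rw [smul_add, map_add]) (fun x y => by rw [map_add, smul_add])
    (fun a b => by
      rw [BTensor.smul_left, actAux_tmul, actAux_tmul, (v.2 l a).1, mul_smul, unit_smul_res]) z

/-- `d ↦ v(d_{(1)})(p(d_{(2)}))`. -/
def actLin (v : S.homLL D) (p : homLD hE S) : D →ₗ[Lᵐᵒᵖ] E.Res S.toComod where
  toFun d := actAux v p (D.comul d)
  map_add' d e := by rw [map_add, map_add]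
  map_smul' l d := (congrArg (actAux v p) (D.comul_op_smul l.unop d)).trans
    (actAux_op_smul v p l _)

theorem actLin_apply (v : S.homLL D) (p : homLD hE S) (d : D) :
    actLin v p d = actAux v p (D.comul d) := rfl

/-- `d ⊗ z ↦ (v(d) p ⊗ D)(z)`. -/
def actAux₃ (v : S.homLL D) (p : homLD hE S) :
    BTensor L D (BTensor L D D) →+ BTensor L (E.Res S.toComod) D :=
  BTensor.lift
    (fun d z => BTensor.map ((E.resMap (v.1 d : S.toComod ⟶ S.toComod)).comp p.1) LinearMap.id z)
    (fun d d' z => by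
      rw [← BTensor.map_add_left]
      refine congrArg (fun f => BTensor.map f LinearMap.id z) (LinearMap.ext fun e => ?_)
      exact (congrArg (fun t : S.T => t • p.1 e) (map_add v.1 d d')).trans (add_smul _ _ _))
    (fun d z z' => map_add _ _ _)
    (fun l d z => BTensor.eq_of_tmul
      (fun z => BTensor.map ((E.resMap (v.1 (op l • d) : S.toComod ⟶ S.toComod)).comp p.1)
        LinearMap.id z)
      (fun z => BTensor.map ((E.resMap (v.1 d : S.toComod ⟶ S.toComod)).comp p.1)
        LinearMap.id (l • z))
      (fun x y => map_add _ _ _) (fun x y => by rw [smul_add, map_add])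
      (fun a b => congrArg (fun x => BTensor.tmul L x b) <| by
        refine (congrArg (fun t : S.T => t • p.1 a) (v.2 l d).2).trans ?_
        rw [mul_smul, unit_smul_res, ← p.2.1]
        rfl) z)

theorem actLin_mem (v : S.homLL D) (p : homLD hE S) : actLin v p ∈ homLD hE S := by
  refine ⟨fun l d => ?_, fun d => ?_⟩
  · rw [actLin_apply, map_smul, actAux_smul, actLin_apply]
  · have h₁ : ∀ z, tau hE S.toComod (actAux v p z) =
        actAux₃ v p (BTensor.map LinearMap.id D.comul z) :=
      BTensor.eq_of_tmul _ _ (fun x y => by rw [map_add, map_add])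
        (fun x y => by rw [map_add, map_add]) fun a b => by
          rw [actAux_tmul, ← resMap_apply, tau_resMap, p.2.2, BTensor.map_map]
          rfl
    have h₂ : ∀ z, BTensor.map (actLin v p) LinearMap.id z =
        actAux₃ v p (BTensor.assoc D D D (BTensor.map D.comulR LinearMap.id z)) :=
      BTensor.eq_of_tmul _ _ (fun x y => map_add _ x y)
        (fun x y => by rw [map_add, map_add, map_add]) fun a b =>
          BTensor.eq_of_tmul
            (fun y => BTensor.tmul L (actAux v p y) b)
            (fun y => actAux₃ v p (BTensor.assoc D D D (BTensor.tmul L y b)))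
            (fun x y => by rw [map_add, BTensor.add_tmul])
            (fun x y => by rw [BTensor.add_tmul, map_add]; exact map_add _ _ _)
            (fun x y => rfl) (D.comul a)
    rw [h₂, actLin_apply, h₁, ← D.coassoc]
    rfl

/-- `d ⊗ (d' ⊗ d'') ↦ v(d) (w(d')(p(d'')))`. -/
def actAuxMul (v w : S.homLL D) (p : homLD hE S) :
    BTensor L D (BTensor L D D) →+ E.Res S.toComod :=
  BTensor.lift (fun d z => v.1 d • actAux w p z) (fun d e z => by rw [map_add, add_smul])
    (fun d z z' => by rw [map_add, smul_add])
    (fun l d z => by rw [(v.2 l d).2, mul_smul, actAux_smul, unit_smul_res])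

/-- `_L Hom^D(D, S)` is a left `_L Hom_L(D, T)`-module: `(v p)(d) = v(d_{(1)})(p(d_{(2)}))`. -/
instance homLDModule : Module (S.homLL D) (homLD hE S) where
  smul v p := ⟨actLin v p, actLin_mem v p⟩
  one_smul p := homLD_ext fun d =>
    (BTensor.eq_of_tmul (fun z => actAux 1 p z) (fun z => p.1 (BTensor.evalLeft D.counitR z))
      (fun x y => map_add _ _ _) (fun x y => by simp only [map_add])
      (fun a b => (p.2.1 (D.counit a) b).symm) (D.comul d)).trans
      (congrArg p.1 (D.evalLeft_counit d))
  mul_smul v w p := homLD_ext fun d => by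
    have h₁ : ∀ z, actAux (v * w) p z =
        actAuxMul v w p (BTensor.assoc D D D (BTensor.map D.comulR LinearMap.id z)) :=
      BTensor.eq_of_tmul _ _ (fun x y => map_add _ _ _)
        (fun x y => by simp only [map_add]) fun a b =>
          BTensor.eq_of_tmul (fun y => convAux v w y • p.1 b)
            (fun y => actAuxMul v w p (BTensor.assoc D D D (BTensor.tmul L y b)))
            (fun x y => by rw [map_add, add_smul])
            (fun x y => by simp only [BTensor.add_tmul, map_add])
            (fun x y => mul_smul _ _ _) (D.comul a)
    have h₂ : ∀ z, actAux v ⟨actLin w p, actLin_mem w p⟩ z =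
        actAuxMul v w p (BTensor.map LinearMap.id D.comul z) :=
      BTensor.eq_of_tmul _ _ (fun x y => map_add _ _ _)
        (fun x y => by simp only [map_add]) fun a b => rfl
    exact (h₁ _).trans ((congrArg (actAuxMul v w p) (D.coassoc d)).trans (h₂ _).symm)
  smul_zero v := homLD_ext fun d =>
    BTensor.eq_of_tmul (fun z => actAux v (0 : homLD hE S) z) (fun z => 0)
      (fun x y => map_add _ _ _) (fun x y => (add_zero 0).symm)
      (fun a b => smul_zero (v.1 a)) (D.comul d)
  smul_add v p p' := homLD_ext fun d =>
    BTensor.eq_of_tmul (fun z => actAux v (p + p') z) (fun z => actAux v p z + actAux v p' z)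
      (fun x y => map_add _ _ _) (fun x y => by rw [map_add, map_add]; abel)
      (fun a b => smul_add (v.1 a) (p.1 b) (p'.1 b)) (D.comul d)
  add_smul v w p := homLD_ext fun d =>
    BTensor.eq_of_tmul (fun z => actAux (v + w) p z) (fun z => actAux v p z + actAux w p z)
      (fun x y => map_add _ _ _) (fun x y => by rw [map_add, map_add]; abel)
      (fun a b => add_smul (v.1 a) (w.1 a) (p.1 b)) (D.comul d)
  zero_smul p := homLD_ext fun d =>
    BTensor.eq_of_tmul (fun z => actAux 0 p z) (fun z => 0)
      (fun x y => map_add _ _ _) (fun x y => (add_zero 0).symm)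
      (fun a b => zero_smul S.T (p.1 b)) (D.comul d)

theorem homLD_smul_apply (v : S.homLL D) (p : homLD hE S) (d : D) :
    (v • p).1 d = actAux v p (D.comul d) := rfl

end Bicomod

namespace Bicomod

open RightExtension

section Qt

variable {A L : Type u} [Ring A] [Ring L] {C : Coring A} [Module Lᵐᵒᵖ C] [SMulCommClass A Lᵐᵒᵖ C]
  (S : Bicomod L C)

/-! #### The right module `Q̃` -/

/-- The left `A`-linear form `c ↦ q(c)(x)` on `C`. -/
def evalAt {S : Bicomod L C} (q : C →ₗ[A] (S →ₗ[Aᵐᵒᵖ] A)) (x : S) : C →ₗ[A] A where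
  toFun c := q c x
  map_add' c c' := by rw [map_add, LinearMap.add_apply]
  map_smul' a c := by rw [map_smul]; rfl

theorem evalRight_add {f g : C →ₗ[A] A} (z : BTensor A C C) :
    BTensor.evalRight (f + g) z = BTensor.evalRight f z + BTensor.evalRight g z :=
  BTensor.eq_of_tmul _ (fun z => BTensor.evalRight f z + BTensor.evalRight g z)
    (fun x y => map_add _ _ _) (fun x y => by rw [map_add, map_add]; abel)
    (fun m n => (congrArg (fun a => op a • m) (LinearMap.add_apply f g n)).trans
      (add_smul (op (f n)) (op (g n)) m)) z

theorem evalLeft_add {M : Type*} [AddCommGroup M] [Module Aᵐᵒᵖ M] {N : Type*} [AddCommGroup N]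
    [Module A N] (f g : M →ₗ[Aᵐᵒᵖ] A) (z : BTensor A M N) :
    BTensor.evalLeft (f + g) z = BTensor.evalLeft f z + BTensor.evalLeft g z :=
  BTensor.eq_of_tmul _ (fun z => BTensor.evalLeft f z + BTensor.evalLeft g z)
    (fun x y => map_add _ _ _) (fun x y => by rw [map_add, map_add]; abel)
    (fun m n => by simp only [BTensor.evalLeft_tmul, LinearMap.add_apply, add_smul]) z

/-- The `A`-`L` bimodule maps `q : C → S^* = Hom_A(S, A)` such that
`c^{(1)} q(c^{(2)})(x) = q(c)(x^{[0]}) x^{[1]}` for all `c` in `C` and `x` in `S`. -/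
def Qt : AddSubgroup (C →ₗ[A] (S →ₗ[Aᵐᵒᵖ] A)) where
  carrier := {q | (∀ (l : L) (c : C) (x : S), q (op l • c) x = q c (l • x)) ∧
    ∀ (c : C) (x : S),
      BTensor.evalRight (evalAt q x) (C.comul c) = BTensor.evalLeft (q c) (S.coact x)}
  add_mem' {q q'} hq hq' :=
    ⟨fun l c x => by simp only [LinearMap.add_apply, hq.1, hq'.1], fun c x => by
      have h : evalAt (q + q') x = evalAt q x + evalAt q' x := LinearMap.ext fun c => rfl
      rw [h, evalRight_add, hq.2, hq'.2, LinearMap.add_apply, evalLeft_add]⟩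
  zero_mem' := ⟨fun l c x => rfl, fun c x =>
    (BTensor.eq_of_tmul (fun z => BTensor.evalRight (evalAt (0 : C →ₗ[A] (S →ₗ[Aᵐᵒᵖ] A)) x) z)
      (fun z => 0) (fun x y => map_add _ _ _) (fun x y => (add_zero 0).symm)
      (fun c c' => zero_smul Aᵐᵒᵖ c) (C.comul c)).trans
    (BTensor.eq_of_tmul (fun z => BTensor.evalLeft (0 : S →ₗ[Aᵐᵒᵖ] A) z)
      (fun z => 0) (fun x y => map_add _ _ _) (fun x y => (add_zero 0).symm)
      (fun x c' => zero_smul A c') (S.coact x)).symm⟩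
  neg_mem' {q} hq :=
    ⟨fun l c x => by simp only [LinearMap.neg_apply, hq.1], fun c x => by
      have h₁ := BTensor.eq_of_tmul (fun z => BTensor.evalRight (evalAt (-q) x) z)
        (fun z => -BTensor.evalRight (evalAt q x) z) (fun x y => map_add _ _ _)
        (fun x y => by rw [map_add, neg_add])
        (fun c c' => neg_smul (op (q c' x)) c) (C.comul c)
      have h₂ := BTensor.eq_of_tmul (fun z : BTensor A S C => BTensor.evalLeft (-(q c)) z)
        (fun z => -BTensor.evalLeft (q c) z) (fun x y => map_add _ _ _)
        (fun x y => by rw [map_add, neg_add])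
        (fun x c' => neg_smul (q c x) c') (S.coact x)
      exact h₁.trans ((congrArg Neg.neg (hq.2 c x)).trans h₂.symm)⟩

end Qt

variable {A L : Type u} [Ring A] [Ring L] {C : Coring A} {D : Coring L}
  [Module Lᵐᵒᵖ C] [SMulCommClass A Lᵐᵒᵖ C] (E : RightExtension C D) {hE : E.IsPure}
  {S : Bicomod L C}

/-- `c ⊗ d ↦ q(c) ∘ v(d)`. -/
def actQAux (q : S.Qt) (v : S.homLL D) : BTensor L C D →ₗ[A] (S →ₗ[Aᵐᵒᵖ] A) where
  toFun := BTensor.lift (fun c d => op (v.1 d) • q.1 c)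
    (fun c c' d => by rw [map_add, smul_add])
    (fun c d d' => by rw [map_add, MulOpposite.op_add, add_smul])
    (fun l c d => by
      rw [(v.2 l d).1, op_mul, mul_smul]
      refine congrArg (fun f => op (v.1 d) • f) (LinearMap.ext fun x => ?_)
      exact q.2.1 l c x)
  map_add' := map_add _
  map_smul' a := BTensor.eq_of_tmul _ _ (fun x y => by rw [smul_add, map_add])
    (fun x y => by rw [map_add, smul_add])
    (fun c d => by
      rw [BTensor.smul_left, BTensor.lift_tmul, BTensor.lift_tmul, map_smul]
      rfl)

theorem actQAux_tmul (q : S.Qt) (v : S.homLL D) (c : C) (d : D) :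
    actQAux q v (BTensor.tmul L c d) = op (v.1 d) • q.1 c := rfl

/-- `c ↦ q(c_{[0]}) ∘ v(c_{[1]})`. -/
def actQ (q : S.Qt) (v : S.homLL D) : C →ₗ[A] (S →ₗ[Aᵐᵒᵖ] A) := (actQAux q v).comp E.coact

theorem actQ_apply (q : S.Qt) (v : S.homLL D) (c : C) :
    actQ E q v c = actQAux q v (E.coact c) := rfl

/-- `z ↦ f(z)(x)`, for a left `A`-linear map `f` with values in `S^*`. -/
def applyAt {M : Type*} [AddCommGroup M] [Module A M] (f : M →ₗ[A] (S →ₗ[Aᵐᵒᵖ] A)) (x : S) :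
    M →ₗ[A] A where
  toFun z := f z x
  map_add' c c' := by rw [map_add, LinearMap.add_apply]
  map_smul' a c := by rw [map_smul]; rfl

theorem actQ_mem (q : S.Qt) (v : S.homLL D) : actQ E q v ∈ S.Qt := by
  refine ⟨fun l c x => ?_, fun c x => ?_⟩
  · refine (congrArg (fun z => actQAux q v z x) (E.coact_op_smul l c)).trans ?_
    exact BTensor.eq_of_tmul (fun z => actQAux q v (op l • z) x)
      (fun z => actQAux q v z (l • x))
      (fun y z => by rw [smul_add, map_add, LinearMap.add_apply])
      (fun y z => by rw [map_add, LinearMap.add_apply])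
      (fun c d => congrArg (fun t : S.T => q.1 c (t • x)) (v.2 l d).2) (E.coact c)
  · have h₁ : ∀ z : BTensor A C C, BTensor.evalRight (evalAt (actQ E q v) x) z =
        BTensor.evalRight (applyAt (actQAux q v) x) (BTensor.map LinearMap.id E.coact z) :=
      BTensor.eq_of_tmul _ _ (fun y z => map_add _ _ _) (fun y z => by rw [map_add, map_add])
        (fun c c' => rfl)
    have h₂ : ∀ z, BTensor.evalRight (applyAt (actQAux q v) x)
        (BTensor.assoc C C D (BTensor.map E.comulL LinearMap.id z)) =
        BTensor.evalLeft (actQAux q v z) (S.coact x) := by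
      refine BTensor.eq_of_tmul _ _ (fun y z => by simp only [map_add])
        (fun y z => by rw [map_add, evalLeft_add]) (fun c d => ?_)
      have k₁ := BTensor.eq_of_tmul (fun y => BTensor.evalRight (applyAt (actQAux q v) x)
          (BTensor.assoc C C D (BTensor.tmul L y d)))
        (fun y => BTensor.evalRight (evalAt q.1 (v.1 d • x : S)) y)
        (fun y z => by simp only [BTensor.add_tmul, map_add]) (fun y z => map_add _ _ _)
        (fun c c' => rfl) (C.comul c)
      have k₂ := BTensor.eq_of_tmul
        (fun y => BTensor.evalLeft (q.1 c)
          (BTensor.map (Comod.lin (v.1 d : S.toComod ⟶ S.toComod)) LinearMap.id y))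
        (fun y => BTensor.evalLeft (N := C) (actQAux q v (BTensor.tmul L c d)) y)
        (fun y z => by simp only [map_add]) (fun y z => map_add _ _ _)
        (fun x c' => rfl) (S.coact x)
      refine Eq.trans ?_ k₂
      rw [Comod.lin_comm]
      exact k₁.trans (q.2.2 c _)
    rw [h₁, actQ_apply, ← h₂, ← E.comul_coact]
    rfl

/-- `c ⊗ (d ⊗ d') ↦ q(c) ∘ v(d) ∘ w(d')`. -/
def actQMul (q : S.Qt) (v w : S.homLL D) :
    BTensor L C (BTensor L D D) →+ (S →ₗ[Aᵐᵒᵖ] A) :=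
  BTensor.lift (fun c z => op (convAux v w z) • q.1 c)
    (fun c c' z => by rw [map_add, smul_add])
    (fun c z z' => by rw [map_add, MulOpposite.op_add, add_smul])
    (fun l c z => by
      have h := BTensor.eq_of_tmul (fun z => convAux v w (l • z))
        (fun z => S.unit l * convAux v w z) (fun x y => by rw [smul_add, map_add])
        (fun x y => by rw [map_add, mul_add])
        (fun d e => (congrArg (· * w.1 e) (v.2 l d).1).trans (mul_assoc _ _ _)) z
      refine Eq.trans ?_ (congrArg (fun t : S.T => op t • q.1 c) h).symm
      refine Eq.trans ?_ (mul_smul (op (convAux v w z)) (op (S.unit l)) (q.1 c)).symm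
      refine congrArg (fun f => op (convAux v w z) • f) (LinearMap.ext fun x => ?_)
      exact q.2.1 l c x)

/-- `Q̃` is a right `_L Hom_L(D, T)`-module: `(q v)(c) = q(c_{[0]}) ∘ v(c_{[1]})`. -/
abbrev QtModule : Module (S.homLL D)ᵐᵒᵖ S.Qt where
  smul v q := ⟨actQ E q v.unop, actQ_mem E q v.unop⟩
  one_smul q := Subtype.ext <| LinearMap.ext fun c =>
    (BTensor.eq_of_tmul (fun z => actQAux q 1 z) (fun z => q.1 (BTensor.evalRight D.counit z))
      (fun x y => map_add _ _ _) (fun x y => by rw [map_add, map_add])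
      (fun c d => LinearMap.ext fun x => (q.2.1 (D.counit d) c x).symm) (E.coact c)).trans
      (congrArg q.1 (E.evalRight_counit c))
  mul_smul v w q := Subtype.ext <| LinearMap.ext fun c => by
    have h₁ : ∀ z, actQAux q (w.unop * v.unop) z =
        actQMul q w.unop v.unop (BTensor.map LinearMap.id D.comul z) :=
      BTensor.eq_of_tmul _ _ (fun x y => map_add _ _ _) (fun x y => by simp only [map_add])
        (fun c d => rfl)
    have h₂ : ∀ z, actQAux ⟨actQ E q w.unop, actQ_mem E q w.unop⟩ v.unop z =
        actQMul q w.unop v.unop (BTensor.assoc C D D (BTensor.map E.coactL LinearMap.id z)) :=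
      BTensor.eq_of_tmul _ _ (fun x y => map_add _ _ _) (fun x y => by simp only [map_add])
        fun c d => BTensor.eq_of_tmul (fun y => op (v.unop.1 d) • actQAux q w.unop y)
          (fun y => actQMul q w.unop v.unop (BTensor.assoc C D D (BTensor.tmul L y d)))
          (fun x y => by rw [map_add, smul_add])
          (fun x y => by simp only [BTensor.add_tmul, map_add])
          (fun c e => (mul_smul (op (v.unop.1 d)) (op (w.unop.1 e)) (q.1 c)).symm) (E.coact c)
    exact (h₁ _).trans ((congrArg (actQMul q w.unop v.unop) (E.coassoc c).symm).trans
      (h₂ _).symm)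
  smul_zero v := Subtype.ext <| LinearMap.ext fun c =>
    BTensor.eq_of_tmul (fun z => actQAux (0 : S.Qt) v.unop z) (fun z => 0)
      (fun x y => map_add _ _ _) (fun x y => (add_zero 0).symm)
      (fun c d => smul_zero (op (v.unop.1 d))) (E.coact c)
  smul_add v q q' := Subtype.ext <| LinearMap.ext fun c =>
    BTensor.eq_of_tmul (fun z => actQAux (q + q') v.unop z)
      (fun z => actQAux q v.unop z + actQAux q' v.unop z)
      (fun x y => map_add _ _ _) (fun x y => by rw [map_add, map_add]; abel)
      (fun c d => smul_add (op (v.unop.1 d)) (q.1 c) (q'.1 c)) (E.coact c)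
  add_smul v w q := Subtype.ext <| LinearMap.ext fun c =>
    BTensor.eq_of_tmul (fun z => actQAux q (v + w).unop z)
      (fun z => actQAux q v.unop z + actQAux q w.unop z)
      (fun x y => map_add _ _ _) (fun x y => by rw [map_add, map_add]; abel)
      (fun c d => add_smul (op (v.unop.1 d)) (op (w.unop.1 d)) (q.1 c)) (E.coact c)
  zero_smul q := Subtype.ext <| LinearMap.ext fun c =>
    BTensor.eq_of_tmul (fun z => actQAux q (unop 0) z) (fun z => 0)
      (fun x y => map_add _ _ _) (fun x y => (add_zero 0).symm)
      (fun c d => zero_smul (S.T)ᵐᵒᵖ (q.1 c)) (E.coact c)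

/-! #### The connecting map -/

/-- The left `C`-colinear right `D`-colinear endomorphisms of `C`. -/
def endCD : AddSubgroup (C →ₗ[A] C) where
  carrier := {u | (∀ c, BTensor.map LinearMap.id u (C.comul c) = C.comul (u c)) ∧
    ∃ u' : C →ₗ[Lᵐᵒᵖ] C, (∀ c, u' c = u c) ∧
      ∀ c, BTensor.map u' LinearMap.id (E.coact c) = E.coact (u c)}
  add_mem' {u w} := by
    rintro ⟨hu, u', hu', hu''⟩ ⟨hw, w', hw', hw''⟩
    refine ⟨fun c => ?_, u' + w', fun c => ?_, fun c => ?_⟩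
    · rw [LinearMap.add_apply, map_add, ← hu, ← hw]
      exact BTensor.eq_of_tmul (fun z => BTensor.map LinearMap.id (u + w) z)
        (fun z => BTensor.map LinearMap.id u z + BTensor.map LinearMap.id w z)
        (fun x y => map_add _ _ _) (fun x y => by rw [map_add, map_add]; abel)
        (fun c d => BTensor.tmul_add c (u d) (w d)) _
    · rw [LinearMap.add_apply, LinearMap.add_apply, hu', hw']
    · rw [BTensor.map_add_left, hu'', hw'', LinearMap.add_apply, map_add]
  zero_mem' := by
    refine ⟨fun c => ?_, 0, fun c => rfl, fun c => ?_⟩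
    · rw [LinearMap.zero_apply, map_zero]
      exact BTensor.eq_of_tmul (fun z => BTensor.map LinearMap.id (0 : C →ₗ[A] C) z)
        (fun z => (0 : BTensor A C C))
        (fun x y => map_add _ _ _) (fun x y => (add_zero 0).symm)
        (fun c d => (by
          have h := BTensor.tmul_add (R := A) c (0 : C) 0
          rwa [add_zero, left_eq_add] at h)) _
    · rw [BTensor.map_zero_left, LinearMap.zero_apply, map_zero]
  neg_mem' {u} := by
    rintro ⟨hu, u', hu', hu''⟩
    refine ⟨fun c => ?_, -u', fun c => ?_, fun c => ?_⟩
    · rw [LinearMap.neg_apply, map_neg, ← hu]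
      refine BTensor.eq_of_tmul (fun z => BTensor.map LinearMap.id (-u) z)
        (fun z => -BTensor.map LinearMap.id u z)
        (fun x y => map_add _ _ _) (fun x y => by rw [map_add, neg_add])
        (fun c d => ?_) _
      have h := map_neg (AddMonoidHom.mk' (BTensor.tmul A c) (BTensor.tmul_add c)) (u d)
      exact h
    · rw [LinearMap.neg_apply, LinearMap.neg_apply, hu']
    · rw [BTensor.map_neg_left, hu'', LinearMap.neg_apply, map_neg]

variable {E}

/-- The left `A`-linear map `C ⊗_L D → A`, `c ⊗ d ↦ q(c)(p(d))`. -/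
def pairing (q : S.Qt) (p : homLD hE S) : BTensor L C D →ₗ[A] A where
  toFun := BTensor.lift (fun c d => q.1 c (show S from p.1 d))
    (fun c c' d => by rw [map_add, LinearMap.add_apply])
    (fun c d d' => (congrArg (q.1 c) (map_add p.1 d d')).trans (map_add (q.1 c) _ _))
    (fun l c d => (q.2.1 l c _).trans (congrArg (q.1 c) (p.2.1 l d).symm))
  map_add' := map_add _
  map_smul' a := BTensor.eq_of_tmul _ _ (fun x y => by rw [smul_add, map_add])
    (fun x y => by rw [map_add, smul_add])
    (fun c d => congrArg (fun f : S →ₗ[Aᵐᵒᵖ] A => f (show S from p.1 d)) (map_smul q.1 a c))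

/-- `c ↦ c^{(1)} q(c^{(2)}_{[0]})(p(c^{(2)}_{[1]}))`. -/
def diamondLin (q : S.Qt) (p : homLD hE S) : C →ₗ[A] C :=
  (evalRightL ((pairing q p).comp E.coact)).comp C.comul

/-- The right `L`-linear map `C ⊗_L D → C`, `c ⊗ d ↦ q(c)(p(d)^{[0]}) p(d)^{[1]}`. -/
def diamondAux (q : S.Qt) (p : homLD hE S) : BTensor L C D →ₗ[Lᵐᵒᵖ] C where
  toFun := BTensor.lift (fun c d => BTensor.evalLeft (q.1 c) (S.coact (show S from p.1 d)))
    (fun c c' d => by rw [map_add, evalLeft_add])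
    (fun c d d' => (congrArg (fun x : S => BTensor.evalLeft (q.1 c) (S.coact x))
      (map_add p.1 d d')).trans
        ((congrArg _ (map_add S.coact _ _)).trans (map_add _ _ _)))
    (fun l c d => by
      refine (q.2.2 _ _).symm.trans (Eq.trans ?_ (q.2.2 _ _))
      rw [E.comul_op_smul]
      refine BTensor.eq_of_tmul
        (fun z => BTensor.evalRight (evalAt q.1 (show S from p.1 d)) (op l • z))
        (fun z => BTensor.evalRight (evalAt q.1 (show S from p.1 (l • d))) z)
        (fun x y => by rw [smul_add, map_add]) (fun x y => map_add _ _ _)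
        (fun c c' => ?_) _
      refine congrArg (fun a : A => op a • c) ?_
      exact (q.2.1 l c' _).trans (congrArg (q.1 c') (p.2.1 l d).symm))
  map_add' := map_add _
  map_smul' l := BTensor.eq_of_tmul _ _ (fun x y => by rw [smul_add, map_add])
    (fun x y => by rw [map_add, smul_add])
    (fun c d => by
      refine (congrArg (BTensor.evalLeft (q.1 c)) ((congrArg (E.rho S.toComod)
        (map_smul p.1 l d)).trans (map_smul (E.rho S.toComod) l (p.1 d)))).trans ?_
      exact BTensor.eq_of_tmul (fun z : BTensor A S C => BTensor.evalLeft (q.1 c) (l • z))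
        (fun z => l • BTensor.evalLeft (q.1 c) z)
        (fun x y => by rw [smul_add, map_add]) (fun x y => by rw [map_add, smul_add])
        (fun x c' => smul_comm (q.1 c x) l c') (S.coact (show S from p.1 d)))

/-- The two forms of the connecting map agree. -/
theorem diamondLin_eq (q : S.Qt) (p : homLD hE S) (c : C) :
    diamondLin q p c = diamondAux q p (E.coact c) := by
  have h₁ : ∀ z : BTensor A C C, BTensor.evalRight ((pairing q p).comp E.coact) z =
      BTensor.evalRight (pairing q p) (BTensor.map LinearMap.id E.coact z) :=
    BTensor.eq_of_tmul _ _ (fun x y => map_add _ _ _) (fun x y => by rw [map_add, map_add])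
      (fun c c' => rfl)
  have h₂ : ∀ z, BTensor.evalRight (pairing q p)
      (BTensor.assoc C C D (BTensor.map E.comulL LinearMap.id z)) = diamondAux q p z :=
    BTensor.eq_of_tmul _ _ (fun x y => by simp only [map_add]) (fun x y => map_add _ _ _)
      (fun c d => (BTensor.eq_of_tmul
        (fun y => BTensor.evalRight (pairing q p) (BTensor.assoc C C D (BTensor.tmul L y d)))
        (fun y => BTensor.evalRight (evalAt q.1 (show S from p.1 d)) y)
        (fun x y => by simp only [BTensor.add_tmul, map_add]) (fun x y => map_add _ _ _)
        (fun c c' => rfl) (C.comul c)).trans (q.2.2 c _))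
  refine (h₁ (C.comul c)).trans (Eq.trans ?_ (h₂ (E.coact c)))
  exact congrArg (BTensor.evalRight (pairing q p)) (E.comul_coact c).symm

theorem diamondLin_mem (q : S.Qt) (p : homLD hE S) : diamondLin q p ∈ endCD E := by
  refine ⟨fun c => ?_, (diamondAux q p).comp E.coactL, fun c => (diamondLin_eq q p c).symm,
    fun c => ?_⟩
  · exact (coact_evalRight ⟨C, C.comulR, C.coassoc, C.evalRight_counit⟩
      ((pairing q p).comp E.coact) c).symm
  · have key : ∀ z, E.coact (diamondAux q p z) = BTensor.map (diamondAux q p) LinearMap.id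
        ((BTensor.assoc C D D).symm (BTensor.map LinearMap.id D.comul z)) := by
      refine BTensor.eq_of_tmul _ _ (fun x y => by simp only [map_add])
        (fun x y => by simp only [map_add]) (fun c d => ?_)
      have k₁ := BTensor.eq_of_tmul
        (fun z : BTensor A S C => E.coact (BTensor.evalLeft (q.1 c) z))
        (fun z => BTensor.evalLeft (q.1 c) (BTensor.map LinearMap.id E.coact z))
        (fun x y => by simp only [map_add]) (fun x y => by simp only [map_add])
        (fun x c' => map_smul E.coact (q.1 c x) c') (S.coact (show S from p.1 d))
      have k₂ : BTensor.map LinearMap.id E.coact (S.coact (show S from p.1 d)) =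
          BTensor.assoc S C D (BTensor.map ((E.rho S.toComod).comp p.1) LinearMap.id
            (D.comul d)) := by
        apply (BTensor.assoc S C D).symm.injective
        rw [AddEquiv.symm_apply_apply]
        refine (map_rho_tau hE S.toComod (p.1 d)).symm.trans ?_
        rw [p.2.2, BTensor.map_map]
        rfl
      have k₃ := BTensor.eq_of_tmul
        (fun z => BTensor.evalLeft (q.1 c) (BTensor.assoc S C D
          (BTensor.map ((E.rho S.toComod).comp p.1) LinearMap.id z)))
        (fun z => BTensor.map (diamondAux q p) LinearMap.id
          ((BTensor.assoc C D D).symm (BTensor.tmul L c z)))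
        (fun x y => by simp only [map_add])
        (fun x y => by simp only [BTensor.tmul_add, map_add])
        (fun a b => BTensor.eq_of_tmul
          (fun z : BTensor A S C => BTensor.evalLeft (q.1 c) (BTensor.assoc S C D
            (BTensor.tmul L z b)))
          (fun z => BTensor.tmul L (BTensor.evalLeft (q.1 c) z) b)
          (fun x y => by simp only [BTensor.add_tmul, map_add])
          (fun x y => by simp only [BTensor.add_tmul, map_add])
          (fun x c' => rfl) (S.coact (show S from p.1 a))) (D.comul d)
      exact k₁.trans ((congrArg (BTensor.evalLeft (q.1 c)) k₂).trans k₃)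
    rw [diamondLin_eq, key, ← E.coassoc, AddEquiv.symm_apply_apply, BTensor.map_map]
    rfl

variable (hE S) in
/-- The connecting map `Q̃ ⊗ _L Hom^D(D, S) → ^C End^D(C)`, where the tensor product is over
`_L Hom_L(D, T)`, given by `(q ⊗ p)(c) = c^{(1)} q(c^{(2)}_{[0]})(p(c^{(2)}_{[1]}))`. -/
def diamond :
    letI : Module (S.homLL D)ᵐᵒᵖ S.Qt := QtModule E
    BTensor (S.homLL D) S.Qt (homLD hE S) →+ endCD E :=
  letI : Module (S.homLL D)ᵐᵒᵖ S.Qt := QtModule E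
  BTensor.lift (fun q p => ⟨diamondLin q p, diamondLin_mem q p⟩)
    (fun q q' p => Subtype.ext <| LinearMap.ext fun c => by
      have h := evalRight_add (f := (pairing q p).comp E.coact) (g := (pairing q' p).comp E.coact)
        (C.comul c)
      refine Eq.trans ?_ h
      refine congrArg (fun f => BTensor.evalRight f (C.comul c)) (LinearMap.ext fun c => ?_)
      exact BTensor.eq_of_tmul (fun z => pairing (q + q') p z)
        (fun z => pairing q p z + pairing q' p z) (fun x y => map_add _ _ _)
        (fun x y => by rw [map_add, map_add]; abel) (fun c d => rfl) (E.coact c))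
    (fun q p p' => Subtype.ext <| LinearMap.ext fun c => by
      have h := evalRight_add (f := (pairing q p).comp E.coact) (g := (pairing q p').comp E.coact)
        (C.comul c)
      refine Eq.trans ?_ h
      refine congrArg (fun f => BTensor.evalRight f (C.comul c)) (LinearMap.ext fun c => ?_)
      exact BTensor.eq_of_tmul (fun z => pairing q (p + p') z)
        (fun z => pairing q p z + pairing q p' z) (fun x y => map_add _ _ _)
        (fun x y => by rw [map_add, map_add]; abel) (fun c d => map_add (q.1 c) _ _) (E.coact c))
    (fun v q p => Subtype.ext <| LinearMap.ext fun c => by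
      refine congrArg (fun f => BTensor.evalRight f (C.comul c)) (LinearMap.ext fun c => ?_)
      let F : BTensor L C (BTensor L D D) →+ A :=
        BTensor.lift (fun c z => q.1 c (show S from actAux v p z))
          (fun c c' z => by rw [map_add, LinearMap.add_apply])
          (fun c z z' => (congrArg (q.1 c) (map_add (actAux v p) z z')).trans
            (map_add (q.1 c) _ _))
          (fun l c z => (q.2.1 l c _).trans (congrArg (q.1 c) (actAux_smul v p l z).symm))
      have h₁ : ∀ z, pairing (op v • q) p z =
          F (BTensor.assoc C D D (BTensor.map E.coactL LinearMap.id z)) :=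
        BTensor.eq_of_tmul _ _ (fun x y => map_add _ _ _) (fun x y => by simp only [map_add])
          (fun c d => BTensor.eq_of_tmul (fun y => actQAux q v y (show S from p.1 d))
            (fun y => F (BTensor.assoc C D D (BTensor.tmul L y d)))
            (fun x y => by rw [map_add, LinearMap.add_apply])
            (fun x y => by simp only [BTensor.add_tmul, map_add])
            (fun c e => rfl) (E.coact c))
      have h₂ : ∀ z, pairing q (v • p) z = F (BTensor.map LinearMap.id D.comul z) :=
        BTensor.eq_of_tmul _ _ (fun x y => map_add _ _ _) (fun x y => by simp only [map_add])
          (fun c d => rfl)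
      exact (h₁ _).trans ((congrArg F (E.coassoc c)).trans (h₂ _).symm))

end Bicomod

end

end CoringMorita

open CoringMorita

/-!
Let `q ∈ Q̃` and let `M` be a right `C`-comodule. The defining identity of `Q̃` says that
`x ↦ m^{[0]} q(m^{[1]})(x)` is a colinear map `S → M` for every `m ∈ M`. Pairing with
`p ∈ _L Hom^D(D, S)` along the coaction `τ_M` gives `θ : M → Hom^C(S, M) ⊗_T S` such that, for the
evaluation map `ev`, both `ev ∘ θ` and `θ ∘ ev` are the action of the form `ε ∘ (q ◆ p)` in the
left dual of `C`, on `M` and on the factor `S` respectively. The forms whose action lifts in this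
way are closed under sums, so if `◆` hits the identity of `C`, then the action of `ε`, which is the
identity, lifts, and `ev_M` is bijective for every `M`. Hence the counit of the adjunction is an
isomorphism and `Hom^C(S, -)` is fully faithful. Up to the isomorphism
`Hom_A(S, N) ≅ Hom^C(S, N ⊗_A C)`, the map `can_N` is `ev` at the cofree comodule `N ⊗_A C`, so `S`
is Galois; the description of the inverse comes from `can_M ∘ incl = ϱ^M ∘ ev_M`.
-/

namespace CoringMorita

noncomputable section

namespace BTensor

section Eval

variable {R M N N' P X : Type*} [Ring R] [AddCommGroup M] [AddCommGroup N] [AddCommGroup N']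
  [AddCommGroup P] [AddCommGroup X] [Module Rᵐᵒᵖ M] [Module Rᵐᵒᵖ P] [Module Rᵐᵒᵖ X]
  [Module R N] [Module R N']

theorem evalRight_add (f g : N →ₗ[R] R) (z : BTensor R M N) :
    evalRight (f + g) z = evalRight f z + evalRight g z :=
  eq_of_tmul _ (fun z => evalRight f z + evalRight g z) (map_add _)
    (fun x y => by rw [map_add, map_add, add_add_add_comm])
    (fun m n => add_smul (op (f n)) (op (g n)) m) z

theorem evalRight_map (f : N' →ₗ[R] R) (g : M →ₗ[Rᵐᵒᵖ] P) (h : N →ₗ[R] N') (z : BTensor R M N) :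
    evalRight f (map g h z) = g (evalRight (f.comp h) z) :=
  eq_of_tmul (fun z => evalRight f (map g h z)) (fun z => g (evalRight (f.comp h) z))
    (fun x y => by rw [map_add, map_add]) (fun x y => by rw [map_add, map_add])
    (fun m n => (map_smul g (op (f (h n))) m).symm) z

/-- The map `M ⊗_R X^* → Hom_R(X, M)`, `m ⊗ ξ ↦ (x ↦ m ξ(x))`, where `X^* = Hom_R(X, R)`. -/
def dualTensorHom : BTensor R M (X →ₗ[Rᵐᵒᵖ] R) →+ (X →ₗ[Rᵐᵒᵖ] M) :=
  lift
    (fun m ξ =>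
      { toFun := fun x => op (ξ x) • m
        map_add' := fun x y => by rw [map_add, MulOpposite.op_add, add_smul]
        map_smul' := fun a x => by
          rw [map_smul, ← op_unop a, op_smul_eq_mul, op_mul, mul_smul, RingHom.id_apply] })
    (fun m m' ξ => LinearMap.ext fun x => smul_add _ m m')
    (fun m ξ η => LinearMap.ext fun x => add_smul (op (ξ x)) (op (η x)) m)
    (fun r m ξ => LinearMap.ext fun x => (mul_smul (op (ξ x)) (op r) m).symm)

theorem dualTensorHom_map (f : M →ₗ[Rᵐᵒᵖ] P) (g : N →ₗ[R] (X →ₗ[Rᵐᵒᵖ] R)) (z : BTensor R M N) :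
    dualTensorHom (map f g z) = f.comp (dualTensorHom (map LinearMap.id g z)) :=
  eq_of_tmul (fun z => dualTensorHom (map f g z))
    (fun z => f.comp (dualTensorHom (map LinearMap.id g z)))
    (fun x y => by rw [map_add, map_add])
    (fun x y => by rw [map_add, map_add, LinearMap.comp_add])
    (fun m n => LinearMap.ext fun x => (map_smul f (op (g n x)) m).symm) z

theorem map_dualTensorHom_tmul (m : M) (ξ : X →ₗ[Rᵐᵒᵖ] R) (w : BTensor R X N) :
    map (dualTensorHom (tmul R m ξ)) LinearMap.id w = tmul R m (evalLeft ξ w) :=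
  eq_of_tmul (fun w => map (dualTensorHom (tmul R m ξ)) LinearMap.id w)
    (fun w => tmul R m (evalLeft ξ w)) (map_add _) (fun x y => by rw [map_add, tmul_add])
    (fun x n => smul_tmul (ξ x) m n) w

end Eval

section TmulLeft

variable {R S M B Q : Type*} [Ring R] [Ring S] [AddCommGroup M] [AddCommGroup B] [AddCommGroup Q]
  [Module Rᵐᵒᵖ M] [Module R B] [Module Sᵐᵒᵖ B] [SMulCommClass R Sᵐᵒᵖ B] [Module S Q]

variable (R S B) in
/-- The map `b ↦ m ⊗ b` of right `S`-modules. -/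
def tmulLeft (m : M) : B →ₗ[Sᵐᵒᵖ] BTensor R M B where
  toFun := tmul R m
  map_add' := tmul_add m
  map_smul' _ _ := rfl

theorem assoc_symm_tmul_eq_map (m : M) (y : BTensor S B Q) :
    (assoc M B Q).symm (tmul R m y) = map (tmulLeft R S B m) LinearMap.id y :=
  eq_of_tmul (fun y => (assoc M B Q).symm (tmul R m y)) _
    (fun x y => by rw [tmul_add, map_add]) (map_add _) (fun _ _ => rfl) y

end TmulLeft

theorem map_linearEquiv_bijective {R M N P : Type*} [Ring R] [AddCommGroup M] [AddCommGroup N]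
    [AddCommGroup P] [Module Rᵐᵒᵖ M] [Module Rᵐᵒᵖ P] [Module R N] (e : M ≃ₗ[Rᵐᵒᵖ] P) :
    Function.Bijective (map (e : M →ₗ[Rᵐᵒᵖ] P) (LinearMap.id : N →ₗ[R] N)) :=
  Function.bijective_iff_has_inverse.2 ⟨map (e.symm : P →ₗ[Rᵐᵒᵖ] M) LinearMap.id,
    fun z => by rw [map_map, e.symm_comp, LinearMap.id_comp, map_id],
    fun z => by rw [map_map, e.comp_symm, LinearMap.id_comp, map_id]⟩

end BTensor

theorem Coring.counit_evalRight_comul {A : Type u} [Ring A] (C : Coring A) (f : C →ₗ[A] A)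
    (c : C) : C.counit (BTensor.evalRight f (C.comul c)) = f c := by
  have h : ∀ z : BTensor A C C,
      C.counit (BTensor.evalRight f z) = f (BTensor.evalLeft C.counitR z) :=
    BTensor.eq_of_tmul _ _ (fun x y => by rw [map_add, map_add])
      (fun x y => by rw [map_add, map_add])
      (fun c d => (C.counit_op_smul (f d) c).trans (map_smul f (C.counit c) d).symm)
  rw [h]
  exact congrArg f (C.evalLeft_counit c)

namespace Comod

variable {A : Type u} [Ring A] {C : Coring A}

theorem coact_injective (M : Comod C) : Function.Injective M.coact :=
  Function.LeftInverse.injective M.evalRight_counit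

theorem isIso_of_bijective {M N : Comod C} (f : M ⟶ N) (hf : Function.Bijective (lin f)) :
    IsIso f := by
  let e : M ≃ₗ[Aᵐᵒᵖ] N := LinearEquiv.ofBijective (lin f) hf
  have he : (e.symm : N →ₗ[Aᵐᵒᵖ] M).comp (lin f) = LinearMap.id := e.symm_comp
  refine ⟨ofLin (e.symm : N →ₗ[Aᵐᵒᵖ] M) fun n => ?_, hom_ext e.symm_apply_apply,
    hom_ext e.apply_symm_apply⟩
  obtain ⟨m, rfl⟩ := hf.2 n
  rw [← lin_comm, BTensor.map_map, he]
  exact (BTensor.map_id _).trans (congrArg M.coact (e.symm_apply_apply m).symm)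

section Cofree

variable (C) (N : Type u) [AddCommGroup N] [Module Aᵐᵒᵖ N]

/-- The coaction `n ⊗ c ↦ (n ⊗ c^{(1)}) ⊗ c^{(2)}` on `N ⊗_A C`. -/
def cofreeCoact : BTensor A N C →ₗ[Aᵐᵒᵖ] BTensor A (BTensor A N C) C where
  toFun z := (BTensor.assoc N C C).symm (BTensor.map LinearMap.id C.comul z)
  map_add' x y := by rw [map_add, map_add]
  map_smul' a := BTensor.eq_of_tmul _ _ (fun x y => by rw [smul_add, map_add, map_add])
    (fun x y => by rw [map_add, map_add, smul_add]) fun n c => by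
      have hΔ : C.comul (a • c) = a • C.comul c := C.comul_op_smul a.unop c
      rw [BTensor.smul_right, BTensor.map_tmul, BTensor.map_tmul, hΔ,
        BTensor.assoc_symm_tmul_eq_map, BTensor.assoc_symm_tmul_eq_map]
      exact map_smul (BTensor.mapR A C (BTensor.tmulLeft A A C n)) a (C.comul c)

theorem cofreeCoact_tmul (n : N) (c : C) :
    cofreeCoact C N (BTensor.tmul A n c) =
      BTensor.map (BTensor.tmulLeft A A C n) LinearMap.id (C.comul c) :=
  BTensor.assoc_symm_tmul_eq_map n (C.comul c)

/-- The map `N ⊗_A ε : N ⊗_A C → N`, the counit of the cofree comodule. -/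
def cofreeCounit : BTensor A N C →ₗ[Aᵐᵒᵖ] N where
  toFun := BTensor.evalRight C.counit
  map_add' := map_add _
  map_smul' a := BTensor.eq_of_tmul _ _ (fun x y => by rw [smul_add, map_add])
    (fun x y => by rw [map_add, smul_add])
    (fun n c => (congrArg (fun b => op b • n) (C.counit_op_smul a.unop c)).trans
      (mul_smul a (op (C.counit c)) n))

/-- `N ⊗_A C` with the coaction `N ⊗_A Δ`: the cofree right `C`-comodule on `N`. -/
def cofree : Comod C where
  carrier := BTensor A N C
  coact := cofreeCoact C N
  coassoc := BTensor.eq_of_tmul _ _ (fun x y => by simp only [map_add])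
    (fun x y => by simp only [map_add]) fun n c => by
      have hΔ : (cofreeCoact C N).comp (BTensor.tmulLeft A A C n) =
          (BTensor.mapR A C (BTensor.tmulLeft A A C n)).comp C.comulR :=
        LinearMap.ext (cofreeCoact_tmul C N n)
      have hΔΔ : BTensor.assoc C C C (BTensor.map C.comulR LinearMap.id (C.comul c)) =
        BTensor.map LinearMap.id C.comul (C.comul c) := C.coassoc c
      rw [cofreeCoact_tmul, BTensor.map_map, BTensor.map_map, hΔ, LinearMap.comp_id,
        ← LinearMap.comp_id (LinearMap.id : C →ₗ[A] C), ← BTensor.map_map, BTensor.assoc_map, hΔΔ,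
        BTensor.mapL_id, BTensor.map_map, LinearMap.comp_id]
      rfl
  evalRight_counit := BTensor.eq_of_tmul _ _ (fun x y => by rw [map_add, map_add])
    (fun x y => rfl) fun n c => by
      rw [cofreeCoact_tmul, BTensor.evalRight_map]
      exact congrArg (BTensor.tmul A n) (C.evalRight_counit c)

variable {C N}

theorem map_cofreeCounit_cofreeCoact (z : BTensor A N C) :
    BTensor.map (cofreeCounit C N) LinearMap.id (cofreeCoact C N z) = z :=
  BTensor.eq_of_tmul (fun z => BTensor.map (cofreeCounit C N) LinearMap.id (cofreeCoact C N z)) id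
    (fun x y => by rw [map_add, map_add]) (fun x y => rfl) (fun n c => by
      have h (y : BTensor A C C) :
          BTensor.map ((cofreeCounit C N).comp (BTensor.tmulLeft A A C n)) LinearMap.id y =
            BTensor.tmul A n (BTensor.evalLeft C.counitR y) :=
        BTensor.eq_of_tmul _ (fun y => BTensor.tmul A n (BTensor.evalLeft C.counitR y)) (map_add _)
          (fun x y => by rw [map_add, BTensor.tmul_add])
          (fun c d => BTensor.smul_tmul (C.counit c) n d) y
      rw [cofreeCoact_tmul, BTensor.map_map, LinearMap.comp_id, h]
      exact congrArg (BTensor.tmul A n) (C.evalLeft_counit c)) z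

theorem map_mapR_comp_coact {S : Comod C} (φ : S →ₗ[Aᵐᵒᵖ] N) (x : S) :
    BTensor.map ((BTensor.mapR A C φ).comp S.coact) LinearMap.id (S.coact x) =
      cofreeCoact C N (BTensor.map φ LinearMap.id (S.coact x)) := by
  refine (AddEquiv.eq_symm_apply _).2 ?_
  rw [← LinearMap.comp_id (LinearMap.id : C →ₗ[A] C), ← BTensor.map_map, BTensor.assoc_map,
    S.coassoc, BTensor.mapL_id, BTensor.map_map, BTensor.map_map, LinearMap.id_comp,
    LinearMap.comp_id, LinearMap.comp_id]
  rfl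

/-- The colinear map `x ↦ φ(x^{[0]}) ⊗ x^{[1]}` corresponding to the `A`-linear map `φ`. -/
def cofreeLift {S : Comod C} (φ : S →ₗ[Aᵐᵒᵖ] N) : S ⟶ cofree C N :=
  ofLin (N := cofree C N) ((BTensor.mapR A C φ).comp S.coact) (map_mapR_comp_coact φ)

/-- The natural isomorphism `Hom_A(S, N) ≅ Hom^C(S, N ⊗_A C)` of right `End^C(S)`-modules. -/
def cofreeHomEquiv (S : Comod C) (N : Type u) [AddCommGroup N] [Module Aᵐᵒᵖ N] :
    (S →ₗ[Aᵐᵒᵖ] N) ≃ₗ[(End S)ᵐᵒᵖ] (S ⟶ cofree C N) where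
  toFun := cofreeLift
  invFun ψ := (cofreeCounit C N).comp (lin ψ)
  map_add' φ φ' := hom_ext fun x => BTensor.map_add_left φ φ' LinearMap.id (S.coact x)
  map_smul' t φ := hom_ext fun x =>
    (BTensor.map_map (lin t.unop) LinearMap.id φ LinearMap.id (S.coact x)).symm.trans
      (congrArg (BTensor.map φ LinearMap.id) (lin_comm t.unop x))
  left_inv φ := LinearMap.ext fun x =>
    (BTensor.evalRight_map C.counit φ LinearMap.id (S.coact x)).trans
      (congrArg φ (S.evalRight_counit x))
  right_inv ψ := hom_ext fun x =>
    (BTensor.map_map (lin ψ) LinearMap.id (cofreeCounit C N) LinearMap.id (S.coact x)).symm.trans <|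
      (congrArg (BTensor.map (cofreeCounit C N) LinearMap.id) (lin_comm ψ x)).trans
        (map_cofreeCounit_cofreeCoact (lin ψ x))

theorem can_eq_evAdd_map_cofreeHomEquiv (S : Comod C) (N : Type u) [AddCommGroup N]
    [Module Aᵐᵒᵖ N] (z : BTensor (End S) (S →ₗ[Aᵐᵒᵖ] N) S) :
    can S N z = evAdd S (cofree C N)
      (BTensor.map (cofreeHomEquiv S N).toLinearMap LinearMap.id z) :=
  BTensor.eq_of_tmul (can S N)
    (fun z => evAdd S (cofree C N) (BTensor.map (cofreeHomEquiv S N).toLinearMap LinearMap.id z))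
    (map_add _) (fun x y => (congrArg (evAdd S (cofree C N)) (map_add _ x y)).trans
      (map_add _ _ _)) (fun _ _ => rfl) z

theorem isGalois_of_bijective_evAdd {S : Comod C}
    (h : ∀ M : Comod C, Function.Bijective (evAdd S M)) : S.IsGalois := by
  intro N _ _
  rw [funext (can_eq_evAdd_map_cofreeHomEquiv S N)]
  exact (h (cofree C N)).comp (BTensor.map_linearEquiv_bijective (cofreeHomEquiv S N))

end Cofree

section Counit

variable {S M : Comod C}

theorem can_incl_eq_coact_counit (z : (indFunctor S).obj ((homFunctor S).obj M)) :
    can S M (incl S M z) = M.coact (lin ((indAdj S).counit.app M) z) :=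
  BTensor.eq_of_tmul (M := (homFunctor S).obj M) (N := S)
    (fun z => can S M (incl S M z)) (fun z => M.coact (evAdd S M z))
    (fun x y => (congrArg (can S M) (map_add (BTensor.map _ _) x y)).trans (map_add _ _ _))
    (fun x y => (congrArg M.coact (map_add (evAdd S M) x y)).trans (map_add _ _ _))
    (fun φ x => lin_comm (φ : S ⟶ M) x) z

theorem incl_injective (h : Function.Injective (evAdd S M)) : Function.Injective (incl S M) :=
  fun x y hxy => h <| M.coact_injective <| by
    have hcan := congrArg (can S M) hxy
    rwa [can_incl_eq_coact_counit, can_incl_eq_coact_counit] at hcan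

theorem incl_inv_counit (hG : S.IsGalois) [IsIso ((indAdj S).counit.app M)] (m : M) :
    incl S M (lin (inv ((indAdj S).counit.app M)) m) = canInv hG M (M.coact m) := by
  refine (Equiv.eq_symm_apply _).2 ((can_incl_eq_coact_counit _).trans (congrArg M.coact ?_))
  exact congrArg (fun f : M ⟶ M => lin f m) (IsIso.inv_hom_id ((indAdj S).counit.app M))

end Counit

section DualAction

/-- The action `m ↦ m^{[0]} f(m^{[1]})` on `M` of a form `f` in the left dual of `C`. -/
def dualAct (M : Comod C) (f : C →ₗ[A] A) : M →+ M :=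
  (BTensor.evalRight f).comp (M.coact : M →+ BTensor A M C)

theorem dualAct_counit (M : Comod C) (m : M) : M.dualAct C.counit m = m := M.evalRight_counit m

theorem dualAct_add (M : Comod C) (f g : C →ₗ[A] A) (m : M) :
    M.dualAct (f + g) m = M.dualAct f m + M.dualAct g m :=
  BTensor.evalRight_add f g (M.coact m)

/-- The action of the form `f` lifts through the evaluation map `ev : Hom^C(S, M) ⊗_T S → M`:
there is `θ` in the opposite direction with `ev ∘ θ = f` and `θ ∘ ev = Hom^C(S, M) ⊗_T f`. -/
def LiftsToHomTensor (S M : Comod C) (f : C →ₗ[A] A) : Prop :=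
  ∃ θ : M →+ BTensor (End S) (S ⟶ M) S, (∀ m, evAdd S M (θ m) = M.dualAct f m) ∧
    ∀ (φ : S ⟶ M) (x : S), θ (lin φ x) = BTensor.tmul (End S) φ (S.dualAct f x)

theorem LiftsToHomTensor.add {S M : Comod C} {f g : C →ₗ[A] A} :
    LiftsToHomTensor S M f → LiftsToHomTensor S M g → LiftsToHomTensor S M (f + g) := by
  rintro ⟨θ, hev, hθ⟩ ⟨θ', hev', hθ'⟩
  refine ⟨θ + θ', fun m => ?_, fun φ x => ?_⟩
  · rw [AddMonoidHom.add_apply, map_add, hev, hev', dualAct_add]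
  · rw [AddMonoidHom.add_apply, hθ, hθ', dualAct_add, BTensor.tmul_add]

theorem LiftsToHomTensor.bijective_evAdd {S M : Comod C} (h : LiftsToHomTensor S M C.counit) :
    Function.Bijective (evAdd S M) := by
  obtain ⟨θ, hev, hθ⟩ := h
  simp only [dualAct_counit] at hev hθ
  exact Function.bijective_iff_has_inverse.2 ⟨θ, BTensor.eq_of_tmul (fun z => θ (evAdd S M z)) id
    (fun x y => by rw [map_add, map_add]) (fun x y => rfl) hθ, hev⟩

end DualAction

end Comod

namespace Bicomod

open RightExtension Comod

variable {A L : Type u} [Ring A] [Ring L] {C : Coring A} {S : Bicomod L C} {M N : Comod C}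

theorem dualTensorHom_map_id_apply (q : C →ₗ[A] (S →ₗ[Aᵐᵒᵖ] A)) (z : BTensor A M C) (x : S) :
    BTensor.dualTensorHom (BTensor.map LinearMap.id q z) x = BTensor.evalRight (evalAt q x) z :=
  BTensor.eq_of_tmul (fun z => BTensor.dualTensorHom (BTensor.map LinearMap.id q z) x) _
    (fun z w => by rw [map_add, map_add, LinearMap.add_apply]) (map_add _) (fun _ _ => rfl) z

variable [Module Lᵐᵒᵖ C]

theorem map_dualTensorHom_coact (q : S.Qt) (m : M) (x : S) :
    BTensor.map (BTensor.dualTensorHom (BTensor.map LinearMap.id q.1 (M.coact m))) LinearMap.id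
      (S.coact x) =
    M.coact (BTensor.dualTensorHom (BTensor.map LinearMap.id q.1 (M.coact m)) x) := by
  rw [dualTensorHom_map_id_apply, coact_evalRight]
  refine BTensor.eq_of_tmul
    (fun z => BTensor.map (BTensor.dualTensorHom (BTensor.map LinearMap.id q.1 z))
      (LinearMap.id : C →ₗ[A] C) (S.coact x))
    (fun z => BTensor.map LinearMap.id ((evalRightL (evalAt q.1 x)).comp C.comul) z)
    (fun z w => by rw [map_add, map_add, BTensor.map_add_left]) (map_add _) (fun m c => ?_) _
  exact (BTensor.map_dualTensorHom_tmul m (q.1 c) (S.coact x)).trans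
    (congrArg (BTensor.tmul A m) (q.2.2 c x).symm)

/-- The colinear map `x ↦ m^{[0]} q(m^{[1]})(x)`, for `q` in `Q̃` and `m` in `M`. -/
def homOfQt (q : S.Qt) : M →+ (S.toComod ⟶ M) :=
  AddMonoidHom.mk' (fun m => Comod.ofLin
      (BTensor.dualTensorHom (BTensor.map LinearMap.id q.1 (M.coact m)))
      (map_dualTensorHom_coact q m))
    (fun m m' => lin_injective <| by simp only [lin_ofLin, lin_add, map_add])

theorem homOfQt_lin (q : S.Qt) (f : M ⟶ N) (m : M) :
    homOfQt q (lin f m) = homOfQt q m ≫ f :=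
  lin_injective <| by
    have h : lin (homOfQt q (lin f m)) = BTensor.dualTensorHom
      (BTensor.map LinearMap.id q.1 (N.coact (lin f m))) := rfl
    rw [h, ← lin_comm, BTensor.map_map]
    exact BTensor.dualTensorHom_map (lin f) q.1 (M.coact m)

variable [SMulCommClass A Lᵐᵒᵖ C] {D : Coring L} {E : RightExtension C D} {hE : E.IsPure}

theorem homOfQt_op_smul (q : S.Qt) (l : L) (m : E.Res M) :
    homOfQt (M := M) q (op l • m) = op (S.unit l) • homOfQt (M := M) q m :=
  hom_ext fun x =>
    (congrArg (fun z => BTensor.dualTensorHom (BTensor.map LinearMap.id q.1 z) x)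
      (map_smul (E.rho M) (op l) m)).trans <|
    BTensor.eq_of_tmul
      (fun z : BTensor A M C => BTensor.dualTensorHom (BTensor.map LinearMap.id q.1 (op l • z)) x)
      (fun z => BTensor.dualTensorHom (BTensor.map LinearMap.id q.1 z) (l • x))
      (fun z w => by rw [smul_add, map_add, map_add, LinearMap.add_apply])
      (fun z w => by rw [map_add, map_add, LinearMap.add_apply])
      (fun n c => congrArg (fun a => op a • n) (q.2.1 l c x)) (M.coact m)

variable (M) in
/-- The map `M ⊗_L D → Hom^C(S, M) ⊗_T S`, `m ⊗ d ↦ m^{[0]} q(m^{[1]})(-) ⊗ p(d)`. -/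
def homTensor (q : S.Qt) (p : homLD hE S) :
    BTensor L (E.Res M) D →+ BTensor S.T (S.toComod ⟶ M) S :=
  BTensor.lift (fun m d => BTensor.tmul S.T (N := S) (homOfQt (M := M) q m) (p.1 d))
    (fun m m' d => (congrArg (fun ψ => BTensor.tmul S.T (N := S) ψ (p.1 d))
      (map_add (homOfQt q) m m')).trans (BTensor.add_tmul _ _ _))
    (fun m d d' => (congrArg (BTensor.tmul S.T (N := S) (homOfQt q m)) (map_add p.1 d d')).trans
      (BTensor.tmul_add _ _ _))
    (fun l m d => by
      rw [homOfQt_op_smul, p.2.1]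
      exact BTensor.smul_tmul (N := S) (S.unit l) (homOfQt q m) (p.1 d))

theorem evAdd_homTensor (q : S.Qt) (p : homLD hE S) (w : BTensor L (E.Res M) D) :
    evAdd S.toComod M (homTensor M q p w) = BTensor.evalRight (pairing q p)
      (BTensor.assoc M C D (BTensor.map (E.rho M) LinearMap.id w)) :=
  BTensor.eq_of_tmul (fun w => evAdd S.toComod M (homTensor M q p w))
    (fun w => BTensor.evalRight (pairing q p)
      (BTensor.assoc M C D (BTensor.map (E.rho M) LinearMap.id w)))
    (fun x y => by rw [map_add, map_add]) (fun x y => by rw [map_add, map_add, map_add])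
    (fun m d => BTensor.eq_of_tmul
      (fun z : BTensor A M C =>
        BTensor.dualTensorHom (BTensor.map LinearMap.id q.1 z) (show S from p.1 d))
      (fun z => BTensor.evalRight (pairing q p) (BTensor.assoc M C D (BTensor.tmul L z d)))
      (fun x y => by rw [map_add, map_add, LinearMap.add_apply])
      (fun x y => by rw [BTensor.add_tmul, map_add, map_add]) (fun _ _ => rfl) (M.coact m)) w

theorem evAdd_homTensor_tau (q : S.Qt) (p : homLD hE S) (m : M) :
    evAdd S.toComod M (homTensor M q p (tau hE M m)) =
      M.dualAct ((pairing q p).comp E.coact) m := by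
  rw [evAdd_homTensor]
  refine (congrArg (fun z => BTensor.evalRight (pairing q p) (BTensor.assoc M C D z))
    (map_rho_tau hE M m)).trans ?_
  rw [preCoact_apply, AddEquiv.apply_symm_apply]
  exact BTensor.evalRight_map (pairing q p) LinearMap.id E.coact (M.coact m)

theorem homTensor_map_resMap (q : S.Qt) (p : homLD hE S) (φ : S.toComod ⟶ M)
    (w : BTensor L (E.Res S.toComod) D) :
    homTensor M q p (BTensor.map (E.resMap φ) LinearMap.id w) =
      BTensor.tmul S.T φ (evAdd S.toComod S.toComod (homTensor S.toComod q p w)) :=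
  BTensor.eq_of_tmul
    (fun w => homTensor M q p (BTensor.map (E.resMap φ) LinearMap.id w))
    (fun w => BTensor.tmul S.T φ (evAdd S.toComod S.toComod (homTensor S.toComod q p w)))
    (fun x y => by rw [map_add, map_add]) (fun x y => by rw [map_add, map_add, BTensor.tmul_add])
    (fun x d => (congrArg (fun ψ => BTensor.tmul S.T (N := S) ψ (p.1 d))
      (homOfQt_lin q φ x)).trans
        (BTensor.smul_tmul (R := S.T) (N := S) (homOfQt (M := S.toComod) q x) φ (p.1 d))) w

theorem liftsToHomTensor_pairing (q : S.Qt) (p : homLD hE S) (M : Comod C) :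
    LiftsToHomTensor S.toComod M ((pairing q p).comp E.coact) := by
  refine ⟨(homTensor M q p).comp (tau hE M), evAdd_homTensor_tau q p, fun φ x => ?_⟩
  rw [← evAdd_homTensor_tau (hE := hE), ← homTensor_map_resMap]
  exact congrArg (homTensor M q p) (tau_resMap hE φ x)

theorem counit_comp_diamondLin (q : S.Qt) (p : homLD hE S) :
    C.counit.comp (diamondLin q p) = (pairing q p).comp E.coact :=
  LinearMap.ext (C.counit_evalRight_comul _)

theorem liftsToHomTensor_of_mem_range_diamond {u : endCD E} (hu : u ∈ Set.range (diamond hE S))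
    (M : Comod C) : LiftsToHomTensor S.toComod M (C.counit.comp u.1) := by
  obtain ⟨z, rfl⟩ := hu
  induction z using BTensor.induction_on with
  | tmul q p => exact counit_comp_diamondLin q p ▸ liftsToHomTensor_pairing q p M
  | add z w hz hw =>
    have h : (diamond hE S (z + w)).1 = (diamond hE S z).1 + (diamond hE S w).1 :=
      congrArg Subtype.val (map_add (diamond hE S) z w)
    rw [h, LinearMap.comp_add]
    exact hz.add hw

theorem id_mem_endCD (E : RightExtension C D) : LinearMap.id ∈ endCD E :=
  ⟨fun _ => BTensor.map_id _, LinearMap.id, fun _ => rfl, fun _ => BTensor.map_id _⟩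

theorem bijective_evAdd_of_surjective_diamond (h : Function.Surjective (diamond hE S))
    (M : Comod C) : Function.Bijective (evAdd S.toComod M) :=
  (liftsToHomTensor_of_mem_range_diamond (h ⟨LinearMap.id, id_mem_endCD E⟩) M).bijective_evAdd

end Bicomod

end

end CoringMorita

theorem mainTheorem4 {A L : Type u} [Ring A] [Ring L] {C : Coring A} {D : Coring L}
    [Module Lᵐᵒᵖ C] [SMulCommClass A Lᵐᵒᵖ C] (E : RightExtension C D) (hE : E.IsPure)
    (S : Bicomod L C) (h : Function.Surjective (Bicomod.diamond hE S)) :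
    (Comod.homFunctor S.toComod).Full ∧ (Comod.homFunctor S.toComod).Faithful ∧
    ∃ hG : S.toComod.IsGalois, ∀ M : Comod C,
      Function.Injective (Comod.incl S.toComod M) ∧
      ∃ θ : M ⟶ (Comod.indFunctor S.toComod).obj ((Comod.homFunctor S.toComod).obj M),
        (∀ m : M, Comod.incl S.toComod M (Comod.lin θ m) = Comod.canInv hG M (M.coact m)) ∧
        θ ≫ (Comod.indAdj S.toComod).counit.app M = 𝟙 M ∧
        (Comod.indAdj S.toComod).counit.app M ≫ θ =
          𝟙 ((Comod.indFunctor S.toComod).obj ((Comod.homFunctor S.toComod).obj M)) := by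
  have hev (M : Comod C) := Bicomod.bijective_evAdd_of_surjective_diamond h M
  have (M : Comod C) : IsIso ((Comod.indAdj S.toComod).counit.app M) :=
    Comod.isIso_of_bijective (Comod.ev S.toComod M) (hev M)
  have : IsIso (Comod.indAdj S.toComod).counit := NatIso.isIso_of_isIso_app _
  let F := (Comod.indAdj S.toComod).fullyFaithfulROfIsIsoCounit
  have hG := Comod.isGalois_of_bijective_evAdd hev
  exact ⟨F.full, F.faithful, hG, fun M => ⟨Comod.incl_injective (hev M).1,
    inv ((Comod.indAdj S.toComod).counit.app M), Comod.incl_inv_counit hG,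
    IsIso.inv_hom_id _, IsIso.hom_inv_id _⟩⟩
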